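/- Definitions. A jumping finite automaton (JFA) is a tuple $M=(Q,\Sigma,R,s,F)$ with a finite state set $Q$, a finite alphabet $\Sigma$, a finite set $R$ of rules $py\to q$ with $p,q\in Q$, $y\in\Sigma^*$ and $|y|\le 1$, a start state $s\in Q$ and a set $F\subseteq Q$ of final states. For configurations in $\Sigma^*Q\Sigma^*$, write $vpw\curvearrowright v'qz'$ if there are a rule $py\to q$ in $R$ and a word $z\in\Sigma^*$ with $w=yz$ and $vz=v'z'$. The language of $M$ is $L(M)=\{uv : u,v\in\Sigma^*,\ usv\curvearrowright^* f \text{ for some } f\in F\}$. An algorithm (a deterministic multi-tape Turing machine) for a decision problem with a size parameter $\kappa$ runs in time $\mathcal{O}^*(2^{o(\kappa)})$ if there are a function $f$ with $f(k)=o(k)$ as $k\to\infty$ and a polynomial $p$ such that on every instance $x$ it halts after at most $2^{f(\kappa(x))}\cdot p(|x|)$ steps, where $|x|$ is the length of the encoding of $x$. The Exponential Time Hypothesis (ETH) is the hypothesis that no algorithm decides in time $\mathcal{O}^*(2^{o(n)})$ whether a given 3-CNF formula (a conjunction of $m$ clauses, each a disjunction of three literals) over $n$ variables is satisfiable. Theorem.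 Unless ETH fails, there is no algorithm that, for a given JFA $M$ with state set $Q$ and a given word $w$ over its alphabet, decides whether $w\in L(M)$ and runs in time $\mathcal{O}^*(2^{o(|Q|)})$. -/

import Mathlib

/-! ### Jumping finite automata -/

/-- A general finite machine `(Q, Σ, R, s, F)`: the triple `(p, y, q) ∈ rules` is the
rule `p y → q`. -/
structure GeneralFiniteMachine (Q A : Type) where
  rules : Set (Q × List A × Q)
  finite_rules : rules.Finite
  start : Q
  final : Set Q

namespace GeneralFiniteMachine

variable {Q A : Type}

/-- A finite machine: every label has length at most one (so `ε`-transitions are allowed). Read with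
the jumping relation below, such a machine is a jumping finite automaton (JFA). -/
def IsFiniteMachine (M : GeneralFiniteMachine Q A) : Prop :=
  ∀ r ∈ M.rules, r.2.1.length ≤ 1

/-- The jumping relation. The triple `(v, p, w)` is the configuration `v p w ∈ Σ* Q Σ*`; we have
`v p w ↷ v' q z'` iff there are a rule `p y → q` and a word `z` with `w = y z` and `v z = v' z'`. -/
def Jump (M : GeneralFiniteMachine Q A) (c d : List A × Q × List A) : Prop :=
  ∃ y z : List A, (c.2.1, y, d.2.1) ∈ M.rules ∧ c.2.2 = y ++ z ∧ c.1 ++ z = d.1 ++ d.2.2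

/-- The language accepted by `M` as a (general) jumping finite automaton. -/
def jumpLanguage (M : GeneralFiniteMachine Q A) : Language A :=
  {w | ∃ u v : List A, ∃ f ∈ M.final, w = u ++ v ∧
    Relation.ReflTransGen M.Jump (u, M.start, v) ([], f, [])}

end GeneralFiniteMachine

/-! ### Instances of the universal word problem for JFA -/

/-- An explicitly given pair of a JFA and a word: the states are `0, …, numStates - 1`, the letters
are `0, …, numLetters - 1`, the sets of final states and of rules are given as lists. The label of
a rule is a letter or (`none`) the empty word. -/
structure JFAWordInstance where
  numStates : ℕ
  numLetters : ℕ
  start : Fin numStates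
  final : List (Fin numStates)
  rules : List (Fin numStates × Option (Fin numLetters) × Fin numStates)
  word : List (Fin numLetters)

namespace JFAWordInstance

/-- The machine `M` of the instance, with state set `Q = Fin numStates`. -/
def machine (I : JFAWordInstance) : GeneralFiniteMachine (Fin I.numStates) (Fin I.numLetters) where
  rules := {r | ∃ t ∈ I.rules, r = (t.1, t.2.1.toList, t.2.2)}
  finite_rules := by
    refine (I.rules.finite_toSet.image fun t => (t.1, t.2.1.toList, t.2.2)).subset ?_
    rintro r ⟨t, ht, rfl⟩
    exact ⟨t, ht, rfl⟩
  start := I.start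
  final := {q | q ∈ I.final}

theorem machine_isFiniteMachine (I : JFAWordInstance) : I.machine.IsFiniteMachine := by
  rintro r ⟨t, -, rfl⟩
  cases t.2.1 <;> simp

/-- The question of the universal word problem: `w ∈ L(M)`. -/
def Accepts (I : JFAWordInstance) : Prop :=
  I.word ∈ I.machine.jumpLanguage

end JFAWordInstance

/-! ### 3SAT -/

/-- A literal over the variables `x_0, …, x_{n-1}`: `(i, true)` is `x_i`, `(i, false)` is `¬ x_i`. -/
abbrev SatLiteral (n : ℕ) : Type := Fin n × Bool

/-- A 3-CNF formula: `numVars` variables and a list of clauses, each a disjunction of three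
literals. -/
structure ThreeCNF where
  numVars : ℕ
  clauses : List (SatLiteral numVars × SatLiteral numVars × SatLiteral numVars)

/-- Some assignment makes a literal of every clause true. -/
def ThreeCNF.Satisfiable (φ : ThreeCNF) : Prop :=
  ∃ ξ : Fin φ.numVars → Bool, ∀ c ∈ φ.clauses,
    ξ c.1.1 = c.1.2 ∨ ξ c.2.1.1 = c.2.1.2 ∨ ξ c.2.2.1 = c.2.2.2

/-! ### Encodings as bit strings

Indices are written in unary. They are smaller than the number of variables, states or letters, so
the length of an encoding is polynomial in the numbers of variables and clauses, respectively of
states, letters, rules, final states and symbols of the word. -/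

/-- `k` is written as `1^k 0`. -/
def encodeUnary (k : ℕ) : List Bool :=
  List.replicate k true ++ [false]

/-- A list is written as `1 x₁ 1 x₂ … 1 xₖ 0`. -/
def encodeBlocks {α : Type} (enc : α → List Bool) (l : List α) : List Bool :=
  l.flatMap (fun x => true :: enc x) ++ [false]

def SatLiteral.encode {n : ℕ} (l : SatLiteral n) : List Bool :=
  encodeUnary l.1 ++ [l.2]

def ThreeCNF.encode (φ : ThreeCNF) : List Bool :=
  encodeUnary φ.numVars ++
    encodeBlocks (fun c => SatLiteral.encode c.1 ++ SatLiteral.encode c.2.1 ++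
      SatLiteral.encode c.2.2) φ.clauses

def JFAWordInstance.encode (I : JFAWordInstance) : List Bool :=
  encodeUnary I.numStates ++ encodeUnary I.numLetters ++ encodeUnary I.start ++
    encodeBlocks (fun q => encodeUnary q) I.final ++
    encodeBlocks (fun r => encodeUnary r.1 ++
      encodeBlocks (fun a => encodeUnary a) r.2.1.toList ++ encodeUnary r.2.2) I.rules ++
    encodeBlocks (fun a => encodeUnary a) I.word

/-! ### Subexponential time and the exponential time hypothesis -/

open Classical in
/-- The problem `P` on instances `x : α`, encoded by `enc` and with size parameter `κ x`, is decided
by an algorithm (a deterministic multi-stack Turing machine) in time `O*(2^{o(κ)})`: there are a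
machine, a function `f` with `f(n) = o(n)` and a polynomial `p` such that the machine, started on
`enc x`, halts with the truth value of `P x` as its output after at most
`2^{f(κ x)} · p(|enc x|)` steps. -/
def DecidableInSubexpTime {α : Type} (enc : α → List Bool) (κ : α → ℕ) (P : α → Prop) : Prop :=
  ∃ (T : Turing.TM2ComputableAux Bool Bool) (f : ℕ → ℝ) (p : Polynomial ℕ),
    f =o[Filter.atTop] (fun n : ℕ => (n : ℝ)) ∧
    ∀ x : α, ∃ t : ℕ,
      (t : ℝ) ≤ (2 : ℝ) ^ f (κ x) * (p.eval (enc x).length : ℕ) ∧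
      Nonempty (Turing.TM2OutputsInTime T.tm ((enc x).map T.inputAlphabet.symm)
        (some ([decide (P x)].map T.outputAlphabet.symm)) t)

/-- The exponential time hypothesis: no algorithm solves 3SAT with `n` variables and `m` clauses in
time `O*(2^{o(n)})`. -/
def ExponentialTimeHypothesis : Prop :=
  ¬ DecidableInSubexpTime ThreeCNF.encode ThreeCNF.numVars ThreeCNF.Satisfiable

/-!
The language of a jumping automaton consists of the words that have a rearrangement accepted by the
automaton when it reads from left to right. A 3-CNF formula becomes an instance of the word problem
as follows: the letters are the clauses, the word contains every letter once, and the automaton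
passes through the variables one after the other, choosing for each of them one of two states and
looping there on the letters of the clauses that contain the corresponding literal. As the order of
the letters is irrelevant, the word is accepted if and only if some assignment satisfies all the
clauses. The automaton has `3 * n + 1` states for `n` variables, and `2 ^ o(3 * n + 1)` is
`2 ^ o(n)`, so a subexponential algorithm for the word problem, run after the reduction, contradicts
the exponential time hypothesis.

That the reduction takes polynomial time on a multi-stack machine is shown by writing it in a small
language of programs on stacks of bits, which is compiled to machines.
-/

namespace GeneralFiniteMachine

variable {Q A : Type} {M : GeneralFiniteMachine Q A}

/-- The machine `M` read as an ordinary automaton, which consumes its input from left to right. -/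
def toεNFA (M : GeneralFiniteMachine Q A) : εNFA A Q where
  step p a := {q | (p, a.toList, q) ∈ M.rules}
  start := {M.start}
  accept := M.final

theorem exists_isPath_of_jump (hM : M.IsFiniteMachine) {c : List A × Q × List A} {f : Q}
    (h : Relation.ReflTransGen M.Jump c ([], f, [])) :
    ∃ l, M.toεNFA.IsPath c.2.1 f l ∧ l.reduceOption.Perm (c.1 ++ c.2.2) := by
  induction h using Relation.ReflTransGen.head_induction_on with
  | refl => exact ⟨[], .nil f, .refl _⟩
  | @head c d hcd _ ih =>
    obtain ⟨y, z, hr, hw, hz⟩ := hcd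
    obtain ⟨l, hl, hperm⟩ := ih
    obtain ⟨a, rfl⟩ : ∃ a : Option A, a.toList = y :=
      match y, hM _ hr with
      | [], _ => ⟨none, rfl⟩
      | [a], _ => ⟨some a, rfl⟩
    refine ⟨a :: l, .cons _ _ _ _ _ hr hl, ?_⟩
    rw [← List.singleton_append, List.reduceOption_append, List.reduceOption_singleton, hw]
    refine (hperm.append_left _).trans ?_
    rw [← hz, ← List.append_assoc, ← List.append_assoc]
    exact List.perm_append_comm.append_right z

theorem exists_jump_of_isPath {p f : Q} {l : List (Option A)} (h : M.toεNFA.IsPath p f l)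
    {w : List A} (hw : w.Perm l.reduceOption) :
    ∃ u v, w = u ++ v ∧ Relation.ReflTransGen M.Jump (u, p, v) ([], f, []) := by
  induction h generalizing w with
  | nil p => exact ⟨[], [], by simpa using hw, .refl⟩
  | cons q p f a l hr _ ih =>
    cases a with
    | none =>
      obtain ⟨u, v, rfl, h⟩ := ih hw
      exact ⟨u, v, rfl, .head (b := (u, q, v)) ⟨[], v, hr, rfl, rfl⟩ h⟩
    | some a =>
      rw [List.reduceOption_cons_of_some] at hw
      obtain ⟨w₁, w₂, rfl⟩ := List.append_of_mem (hw.symm.subset List.mem_cons_self)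
      obtain ⟨u, v, huv, h⟩ := ih (List.perm_middle.symm.trans hw).cons_inv
      exact ⟨w₁, a :: w₂, rfl, .head (b := (u, q, v)) ⟨[a], w₂, hr, rfl, huv⟩ h⟩

theorem mem_jumpLanguage_iff (hM : M.IsFiniteMachine) {w : List A} :
    w ∈ M.jumpLanguage ↔ ∃ l ∈ M.toεNFA.accepts, l.Perm w := by
  simp only [εNFA.mem_accepts_iff_exists_path]
  constructor
  · rintro ⟨u, v, f, hf, rfl, h⟩
    obtain ⟨l, hl, hperm⟩ := exists_isPath_of_jump hM h
    exact ⟨_, ⟨_, f, l, rfl, hf, rfl, hl⟩, hperm⟩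
  · rintro ⟨_, ⟨_, f, l, rfl, hf, rfl, hl⟩, hperm⟩
    obtain ⟨u, v, huv, h⟩ := exists_jump_of_isPath hl hperm.symm
    exact ⟨u, v, f, hf, huv, h⟩

theorem isPath_map_some_append {p f : Q} {a : List A} {l : List (Option A)}
    (ha : ∀ x ∈ a, (p, [x], p) ∈ M.rules) (hl : M.toεNFA.IsPath p f l) :
    M.toεNFA.IsPath p f (a.map some ++ l) := by
  induction a with
  | nil => exact hl
  | cons x a ih =>
    rw [List.forall_mem_cons] at ha
    exact .cons _ _ _ _ _ ha.1 (ih ha.2)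

end GeneralFiniteMachine

namespace ThreeCNF

/-- The clauses over `n` variables, as they occur in a 3-CNF formula. -/
abbrev Clause (n : ℕ) : Type := SatLiteral n × SatLiteral n × SatLiteral n

/-- The literals of a clause. -/
def Clause.literals {n : ℕ} (c : Clause n) : List (SatLiteral n) :=
  [c.1, c.2.1, c.2.2]

/-- The state `3 * i`, in which the value of the variable `x_i` is chosen; for `i = n` it is the
final state. -/
def hub {n : ℕ} (i : ℕ) (hi : i ≤ n) : Fin (3 * n + 1) :=
  ⟨3 * i, by omega⟩

/-- The state entered when the literal `l` is made true: `3 * k + 1` for `x_k` and `3 * k + 2` for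
`¬ x_k`. -/
def litState {n : ℕ} (l : SatLiteral n) : Fin (3 * n + 1) :=
  ⟨3 * l.1 + cond l.2 1 2, by have := l.1.2; cases l.2 <;> simp only [cond] <;> omega⟩

/-- The rules that read the letter of the clause `c`, in the states of its literals. -/
def loopRules {n m : ℕ} (c : Clause n) (j : Fin m) :
    List (Fin (3 * n + 1) × Option (Fin m) × Fin (3 * n + 1)) :=
  c.literals.map fun l => (litState l, some j, litState l)

/-- The rules that choose a value of the variable `x_i`. -/
def choiceRules {n : ℕ} (m : ℕ) (i : Fin n) :
    List (Fin (3 * n + 1) × Option (Fin m) × Fin (3 * n + 1)) :=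
  [(hub i i.2.le, none, litState (i, true)), (litState (i, true), none, hub (i + 1) i.2),
    (hub i i.2.le, none, litState (i, false)), (litState (i, false), none, hub (i + 1) i.2)]

/-- The instance of the universal word problem to which a formula is reduced: the machine passes
through one state for every variable, choosing its value, and the letters are the clauses. Variables
and letters are enumerated backwards because this is the order in which a machine writes them when
it counts down in unary. -/
def toJFA (φ : ThreeCNF) : JFAWordInstance where
  numStates := 3 * φ.numVars + 1
  numLetters := φ.clauses.length
  start := hub 0 (Nat.zero_le _)
  final := [hub φ.numVars le_rfl]
  rules := (List.finRange φ.clauses.length).flatMap (fun j => loopRules (φ.clauses.get j) j) ++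
    (List.finRange φ.numVars).reverse.flatMap (choiceRules φ.clauses.length)
  word := (List.finRange φ.clauses.length).reverse

/-- The automaton of `φ.toJFA`, with its alphabet and its state set made explicit. -/
def automaton (φ : ThreeCNF) : εNFA (Fin φ.clauses.length) (Fin (3 * φ.numVars + 1)) :=
  φ.toJFA.machine.toεNFA

theorem litState_ne_hub {n i : ℕ} (hi : i ≤ n) (l : SatLiteral n) : litState l ≠ hub i hi := by
  obtain ⟨k, b⟩ := l
  cases b <;> simp [litState, hub, Fin.ext_iff] <;> omega

theorem litState_injective {n : ℕ} : Function.Injective (litState (n := n)) := by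
  rintro ⟨i, b⟩ ⟨i', b'⟩ h
  cases b <;> cases b' <;> simp [litState, Fin.ext_iff] at h ⊢ <;> omega

theorem litState_le {n : ℕ} (l : SatLiteral n) : (litState l : ℕ) ≤ 3 * l.1 + 2 := by
  obtain ⟨k, b⟩ := l
  cases b <;> simp [litState]

variable {φ : ThreeCNF}

theorem mem_step_automaton_iff {p q : Fin (3 * φ.numVars + 1)}
    {a : Option (Fin φ.clauses.length)} :
    q ∈ φ.automaton.step p a ↔ (∃ j, (p, a, q) ∈ loopRules (φ.clauses.get j) j) ∨
      ∃ i, (p, a, q) ∈ choiceRules φ.clauses.length i := by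
  have toList_injective : Function.Injective (Option.toList (α := Fin φ.clauses.length)) := by
    intro a b h
    cases a <;> cases b <;> simp_all
  have step_iff_mem_rules : q ∈ φ.automaton.step p a ↔ (p, a, q) ∈ φ.toJFA.rules := by
    constructor
    · rintro ⟨⟨p', a', q'⟩, ht, h⟩
      obtain ⟨rfl, h⟩ := Prod.mk.inj h
      obtain ⟨h, rfl⟩ := Prod.mk.inj h
      exact toList_injective h ▸ ht
    · exact fun h => ⟨_, h, rfl⟩
  refine step_iff_mem_rules.trans (List.mem_append.trans ?_)
  rw [List.mem_flatMap, List.mem_flatMap]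
  simp only [List.mem_finRange, List.mem_reverse, true_and]

theorem mem_step_automaton_some_iff {p q : Fin (3 * φ.numVars + 1)} {j : Fin φ.clauses.length} :
    q ∈ φ.automaton.step p (some j) ↔
      ∃ l ∈ Clause.literals (φ.clauses.get j), litState l = p ∧ litState l = q := by
  rw [mem_step_automaton_iff]
  simp [loopRules, choiceRules, -Prod.exists]

theorem mem_step_automaton_none_iff {p q : Fin (3 * φ.numVars + 1)} :
    q ∈ φ.automaton.step p none ↔ ∃ (i : Fin φ.numVars) (b : Bool),
      p = hub i i.2.le ∧ q = litState (i, b) ∨ p = litState (i, b) ∧ q = hub (i + 1) i.2 := by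
  rw [mem_step_automaton_iff]
  simp only [loopRules, choiceRules, List.mem_map, List.mem_cons, List.not_mem_nil, or_false,
    Prod.mk.injEq, reduceCtorEq, false_and, and_false, exists_false, true_and, false_or,
    Bool.exists_bool]
  refine exists_congr fun i => ?_
  tauto

theorem exists_assignment_of_isPath {p f : Fin (3 * φ.numVars + 1)}
    {l : List (Option (Fin φ.clauses.length))} (h : φ.automaton.IsPath p f l)
    (hf : f = hub φ.numVars le_rfl) :
    ∃ ξ : Fin φ.numVars → Bool, (∀ x, p = litState x → ξ x.1 = x.2) ∧
      ∀ j, some j ∈ l → ∃ x ∈ Clause.literals (φ.clauses.get j), ξ x.1 = x.2 ∧ p ≤ litState x := by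
  induction h with
  | nil p =>
    exact ⟨fun _ => true, fun x hx => absurd (hx.symm.trans hf) (litState_ne_hub _ x), by simp⟩
  | cons q p f a l hstep _ ih =>
    obtain ⟨ξ, hq, hl⟩ := ih hf
    cases a with
    | some j =>
      obtain ⟨x, hx, rfl, rfl⟩ := mem_step_automaton_some_iff.1 hstep
      refine ⟨ξ, hq, fun k hk => ?_⟩
      rcases List.mem_cons.1 hk with ⟨⟨⟩⟩ | hk
      · exact ⟨x, hx, hq x rfl, le_rfl⟩
      · exact hl k hk
    | none =>
      obtain ⟨i, b, ⟨rfl, rfl⟩ | ⟨rfl, rfl⟩⟩ := mem_step_automaton_none_iff.1 hstep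
      · refine ⟨ξ, fun x hx => absurd hx.symm (litState_ne_hub _ x), fun k hk => ?_⟩
        obtain ⟨x, hx, hξ, hle⟩ := hl k (by simpa using hk)
        refine ⟨x, hx, hξ, le_trans ?_ hle⟩
        simp [Fin.le_def, hub, litState]
      · refine ⟨Function.update ξ i b, fun x hx => ?_, fun k hk => ?_⟩
        · obtain rfl := litState_injective hx
          simp
        · obtain ⟨x, hx, hξ, hle⟩ := hl k (by simpa using hk)
          have hi : 3 * (i + 1) ≤ (litState x : ℕ) := hle
          have hne : x.1 ≠ i := by
            rintro rfl
            have := litState_le x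
            omega
          refine ⟨x, hx, by rw [Function.update_of_ne hne, hξ], Fin.le_def.2 ?_⟩
          exact (litState_le _).trans (.trans (by simp only; omega) hi)

theorem exists_isPath_of_assignment (ξ : Fin φ.numVars → Bool)
    (v : Fin φ.clauses.length → Fin φ.numVars)
    (hv : ∀ j, (v j, ξ (v j)) ∈ Clause.literals (φ.clauses.get j)) {i : ℕ} (hi : i ≤ φ.numVars) :
    ∃ l, φ.automaton.IsPath (hub i hi) (hub φ.numVars le_rfl) l ∧
      l.reduceOption.Perm
        ((List.finRange φ.clauses.length).filter fun j => decide (i ≤ v j)) := by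
  induction hi using Nat.decreasingInduction with
  | self =>
    exact ⟨[], .nil _, by simp⟩
  | of_succ i hi ih =>
    obtain ⟨l, hl, hperm⟩ := ih
    let i' : Fin φ.numVars := ⟨i, hi⟩
    let a := (List.finRange φ.clauses.length).filter fun j => decide (v j = i')
    have path_loops : φ.automaton.IsPath (litState (i', ξ i')) (hub φ.numVars le_rfl)
        (a.map some ++ none :: l) := by
      refine GeneralFiniteMachine.isPath_map_some_append (fun j hj => ?_)
        (.cons _ _ _ _ _ (mem_step_automaton_none_iff.2 ⟨i', ξ i', .inr ⟨rfl, rfl⟩⟩) hl)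
      have hj : v j = i' := by simpa [a] using hj
      exact mem_step_automaton_some_iff.2 ⟨(i', ξ i'), hj ▸ hv j, rfl, rfl⟩
    refine ⟨_, .cons _ _ _ _ _ (mem_step_automaton_none_iff.2 ⟨i', ξ i', .inl ⟨rfl, rfl⟩⟩)
      path_loops, ?_⟩
    have reduceOption_eq : (none :: (a.map some ++ none :: l)).reduceOption =
        a ++ l.reduceOption := by
      simp [List.reduceOption]
    rw [reduceOption_eq]
    refine (hperm.append_left a).trans (.trans (.of_eq ?_)
      (List.filter_append_perm (fun j => decide (v j = i')) _))
    rw [List.filter_filter, List.filter_filter]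
    congr 1 <;> apply List.filter_congr <;> intro j _ <;>
      simp only [i', Fin.ext_iff, ← Bool.decide_and, ← decide_not, decide_eq_decide] <;> omega

theorem satisfiable_iff_forall_exists_literal :
    φ.Satisfiable ↔ ∃ ξ : Fin φ.numVars → Bool, ∀ j,
      ∃ x ∈ Clause.literals (φ.clauses.get j), ξ x.1 = x.2 := by
  simp only [Satisfiable, List.forall_mem_iff_get, Clause.literals, List.mem_cons,
    List.not_mem_nil, or_false, exists_eq_or_imp, exists_eq_left]

theorem accepts_toJFA_iff : φ.toJFA.Accepts ↔ φ.Satisfiable := by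
  have accepts_iff : φ.toJFA.Accepts ↔ ∃ l,
      φ.automaton.IsPath (hub 0 (Nat.zero_le _)) (hub φ.numVars le_rfl) l ∧
        l.reduceOption.Perm (List.finRange φ.clauses.length) := by
    rw [JFAWordInstance.Accepts,
      GeneralFiniteMachine.mem_jumpLanguage_iff φ.toJFA.machine_isFiniteMachine]
    simp only [εNFA.mem_accepts_iff_exists_path]
    constructor
    · rintro ⟨_, ⟨_, f, l, rfl, hf, rfl, hl⟩, hperm⟩
      obtain rfl : f = hub φ.numVars le_rfl := List.mem_singleton.1 hf
      exact ⟨l, hl, hperm.trans (List.reverse_perm _)⟩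
    · rintro ⟨l, hl, hperm⟩
      exact ⟨_, ⟨_, _, l, rfl, List.mem_singleton.2 rfl, rfl, hl⟩,
        hperm.trans (List.reverse_perm _).symm⟩
  rw [accepts_iff, satisfiable_iff_forall_exists_literal]
  constructor
  · rintro ⟨l, hl, hperm⟩
    obtain ⟨ξ, -, hξ⟩ := exists_assignment_of_isPath hl rfl
    refine ⟨ξ, fun j => ?_⟩
    have hj : j ∈ l.reduceOption := hperm.symm.subset (List.mem_finRange j)
    obtain ⟨x, hx, hxξ, -⟩ := hξ j (List.reduceOption_mem_iff.1 hj)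
    exact ⟨x, hx, hxξ⟩
  · rintro ⟨ξ, h⟩
    choose x hx hxξ using h
    obtain ⟨l, hl, hperm⟩ := exists_isPath_of_assignment ξ (fun j => (x j).1)
      (fun j => by rw [hxξ]; exact hx j) (Nat.zero_le _)
    exact ⟨l, hl, by simpa using hperm⟩

end ThreeCNF

namespace StackMachine

open Turing Function

section ReachesIn

variable {σ τ : Type*} {f : σ → Option σ} {a b c : σ} {s t : ℕ}

/-- The partial function `f`, applied repeatedly, leads from `a` to `b` in at most `t` steps. -/
def ReachesIn (f : σ → Option σ) (a b : σ) (t : ℕ) : Prop :=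
  Nonempty (StateTransition.EvalsToInTime f a (some b) t)

theorem ReachesIn.refl (f : σ → Option σ) (a : σ) : ReachesIn f a a 0 :=
  ⟨.refl f a⟩

theorem ReachesIn.single (h : f a = some b) : ReachesIn f a b 1 :=
  ⟨⟨⟨1, h⟩, le_rfl⟩⟩

theorem ReachesIn.trans (hab : ReachesIn f a b s) (hbc : ReachesIn f b c t) :
    ReachesIn f a c (s + t) := by
  obtain ⟨hab⟩ := hab
  obtain ⟨hbc⟩ := hbc
  exact add_comm s t ▸ ⟨hab.trans f s t a b _ hbc⟩

theorem ReachesIn.mono (h : ReachesIn f a b s) (hst : s ≤ t) : ReachesIn f a b t :=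
  h.map fun h => ⟨h.toEvalsTo, h.steps_le_m.trans hst⟩

theorem ReachesIn.eq_or_exists_head (h : ReachesIn f a b t) :
    a = b ∨ ∃ c s, f a = some c ∧ ReachesIn f c b s ∧ t = s + 1 := by
  obtain ⟨⟨⟨n, hn⟩, hnt⟩⟩ := h
  cases n with
  | zero => exact .inl (Option.some_injective _ hn)
  | succ n =>
    rw [iterate_succ_apply] at hn
    cases hc : f a with
    | none =>
      rw [show flip bind f (some a) = none from hc, iterate_fixed (by rfl)] at hn
      exact absurd hn (Option.some_ne_none b).symm
    | some c =>
      rw [show flip bind f (some a) = some c from hc] at hn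
      exact .inr ⟨c, t - 1, rfl, ⟨⟨n, hn⟩, by dsimp only at hnt ⊢; omega⟩, by
        dsimp only at hnt; omega⟩

theorem ReachesIn.exists_of_simulation {g : τ → Option τ} {R : σ → τ → Prop}
    (hR : ∀ ⦃a a' b⦄, R a b → f a = some a' → ∃ b', R a' b' ∧ g b = some b') {a a' : σ} {b : τ}
    (h : ReachesIn f a a' t) (hab : R a b) : ∃ b', R a' b' ∧ ReachesIn g b b' t := by
  induction t generalizing a b with
  | zero =>
    obtain rfl | ⟨_, _, _, _, ⟨⟩⟩ := h.eq_or_exists_head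
    exact ⟨b, hab, .refl g b⟩
  | succ t ih =>
    obtain rfl | ⟨c, _, hac, hc, ⟨⟩⟩ := h.eq_or_exists_head
    · exact ⟨b, hab, (ReachesIn.refl g b).mono (Nat.zero_le _)⟩
    · obtain ⟨d, hcd, hbd⟩ := hR hab hac
      obtain ⟨b', hab', hd⟩ := ih hc hcd
      exact ⟨b', hab', add_comm 1 t ▸ (ReachesIn.single hbd).trans hd⟩

theorem ReachesIn.measure_le {μ : σ → ℕ} {C : ℕ} (hμ : ∀ ⦃a b⦄, f a = some b → μ b ≤ μ a + C)
    (h : ReachesIn f a b t) : μ b ≤ μ a + C * t := by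
  induction t generalizing a with
  | zero =>
    obtain rfl | ⟨_, _, _, _, ⟨⟩⟩ := h.eq_or_exists_head
    exact Nat.le_add_right _ _
  | succ t ih =>
    obtain rfl | ⟨c, _, hac, hc, ⟨⟩⟩ := h.eq_or_exists_head
    · exact Nat.le_add_right _ _
    · linarith [ih hc, hμ hac, mul_add_one C t]

end ReachesIn

/-- A component of type `τ` of the internal states `σ` of a machine. -/
structure Component (σ τ : Type*) where
  get : σ → τ
  set : τ → σ → σ
  get_set : ∀ x v, get (set x v) = x
  set_set : ∀ x y v, set x (set y v) = set x v

section ContinueAt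

variable {K Λ σ : Type*} {Γ : K → Type*} [DecidableEq K]

/-- The statement that jumps to the label `l`, if there is one, and halts otherwise. -/
def continueAt (l : Option Λ) : TM2.Stmt Γ Λ σ :=
  l.elim .halt fun l => .goto fun _ => l

theorem stepAux_continueAt (l : Option Λ) (v : σ) (S : ∀ k, List (Γ k)) :
    TM2.stepAux (continueAt l) v S = ⟨l, v, S⟩ := by
  cases l <;> rfl

end ContinueAt

section Move

variable {K Λ σ τ : Type*} {Γ : K → Type*} [DecidableEq K] [Inhabited τ]

/-- The body of the loop `self` that moves the symbols of the stack `src`, translated by `f` and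
`g`, one by one to the stack `dst`, and then continues with `exit`. The symbol in transit is kept
in the component `buffer`. -/
def moveStmt (buffer : Component σ (Option τ)) (src dst : K) (f : Γ src → τ) (g : τ → Γ dst)
    (self : Λ) (exit : Option Λ) : TM2.Stmt Γ Λ σ :=
  .pop src (fun v x => buffer.set (x.map f) v)
    (.branch (fun v => (buffer.get v).isSome)
      (.push dst (fun v => g ((buffer.get v).getD default)) (.goto fun _ => self))
      (continueAt exit))

variable {M : Λ → TM2.Stmt Γ Λ σ} {buffer : Component σ (Option τ)} {src dst : K} {f : Γ src → τ}
  {g : τ → Γ dst} {self : Λ} {exit : Option Λ}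

theorem reachesIn_moveStmt (hne : src ≠ dst) (hM : M self = moveStmt buffer src dst f g self exit)
    (v : σ) {l : List (Γ src)} {S : ∀ k, List (Γ k)} (hl : S src = l) :
    ReachesIn (TM2.step M) ⟨some self, v, S⟩
      ⟨exit, buffer.set none v,
        update (update S src []) dst ((l.map fun x => g (f x)).reverse ++ S dst)⟩
      (l.length + 1) := by
  induction l generalizing v S with
  | nil =>
    refine .single ?_
    simp only [TM2.step, hM, moveStmt, TM2.stepAux, hl, List.head?_nil, Option.map_none,
      buffer.get_set, Option.isSome_none, cond_false, stepAux_continueAt, List.tail_nil,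
      List.map_nil, List.reverse_nil, List.nil_append]
    rw [← update_of_ne hne.symm ([] : List (Γ src)) S, update_eq_self]
  | cons x l ih =>
    let S' := update (update S src l) dst (g (f x) :: S dst)
    have step : TM2.step M ⟨some self, v, S⟩ = some ⟨some self, buffer.set (some (f x)) v,
        S'⟩ := by
      simp [TM2.step, TM2.stepAux, hM, moveStmt, hl, buffer.get_set, hne.symm, S']
    have final_stacks : update (update S' src []) dst
        ((l.map fun x => g (f x)).reverse ++ S' dst) = update (update S src []) dst
          (((x :: l).map fun x => g (f x)).reverse ++ S dst) := by
      rw [show S' dst = g (f x) :: S dst from update_self ..]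
      simp only [S', update_comm hne.symm, update_idem, List.map_cons, List.reverse_cons,
        List.append_assoc, List.singleton_append]
    have rest := ih (buffer.set (some (f x)) v) (S := S') (by simp [S', hne])
    rw [buffer.set_set, final_stacks] at rest
    exact add_comm 1 (l.length + 1) ▸ (ReachesIn.single step).trans rest

theorem reachesIn_moveStmt_update (hne : src ≠ dst)
    (hM : M self = moveStmt buffer src dst f g self exit) (v : σ) {l : List (Γ src)}
    {l' : List (Γ dst)} (hl : (l.map fun x => g (f x)).reverse = l') :
    ReachesIn (TM2.step M) ⟨some self, v, update (fun _ => []) src l⟩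
      ⟨exit, buffer.set none v, update (fun _ => []) dst l'⟩ (l.length + 1) := by
  have h := reachesIn_moveStmt hne hM v (S := update (fun _ => []) src l) (update_self ..)
  rwa [update_idem, update_of_ne hne.symm, List.append_nil, update_eq_self src (fun _ => []),
    hl] at h

end Move

section Lift

variable {K K₁ Λ Λ₁ σ σ₁ : Type*} {Γ : K → Type*} [DecidableEq K] [DecidableEq K₁]

/-- A statement of a machine with stacks `K₁` as a statement of a larger machine, whose stacks
`ι k` play the role of the stacks `k`. It operates on the component `state` of the internal state,
jumps to the labels `lab l` instead of `l`, and jumps to `exit` (if there is one) instead of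
halting. -/
def liftStmt (ι : K₁ → K) (state : Component σ σ₁) (lab : Λ₁ → Λ) (exit : Option Λ) :
    TM2.Stmt (fun k => Γ (ι k)) Λ₁ σ₁ → TM2.Stmt Γ Λ σ
  | .push k f q => .push (ι k) (fun v => f (state.get v)) (liftStmt ι state lab exit q)
  | .peek k f q =>
    .peek (ι k) (fun v x => state.set (f (state.get v) x) v) (liftStmt ι state lab exit q)
  | .pop k f q =>
    .pop (ι k) (fun v x => state.set (f (state.get v) x) v) (liftStmt ι state lab exit q)
  | .load f q => .load (fun v => state.set (f (state.get v)) v) (liftStmt ι state lab exit q)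
  | .branch f q₁ q₂ => .branch (fun v => f (state.get v)) (liftStmt ι state lab exit q₁)
      (liftStmt ι state lab exit q₂)
  | .goto f => .goto fun v => lab (f (state.get v))
  | .halt => continueAt exit

/-- The configuration `d` of the larger machine represents the configuration `c` of the smaller
one, and outside of the smaller machine it agrees with the state `v₀` and the stacks `S₀`. -/
structure Represents (ι : K₁ → K) (state : Component σ σ₁) (lab : Λ₁ → Λ) (exit : Option Λ)
    (v₀ : σ) (S₀ : ∀ k, List (Γ k)) (c : TM2.Cfg (fun k => Γ (ι k)) Λ₁ σ₁) (d : TM2.Cfg Γ Λ σ) :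
    Prop where
  label : d.l = c.l.elim exit fun l => some (lab l)
  var : d.var = state.set c.var v₀
  stk : (fun k => d.stk (ι k)) = c.stk
  frame : ∀ k ∉ Set.range ι, d.stk k = S₀ k

variable {ι : K₁ → K} {state : Component σ σ₁} {lab : Λ₁ → Λ} {exit : Option Λ}
  {v₀ : σ} {S₀ : ∀ k, List (Γ k)}

theorem represents_stepAux_liftStmt (hι : Injective ι) (q : TM2.Stmt (fun k => Γ (ι k)) Λ₁ σ₁)
    (v : σ₁) {S : ∀ k, List (Γ k)} (hS : ∀ k ∉ Set.range ι, S k = S₀ k) :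
    Represents ι state lab exit v₀ S₀ (TM2.stepAux q v fun k => S (ι k))
      (TM2.stepAux (liftStmt ι state lab exit q) (state.set v v₀) S) := by
  have update_frame : ∀ {S : ∀ k, List (Γ k)}, (∀ k ∉ Set.range ι, S k = S₀ k) →
      ∀ (k : K₁) (x : List (Γ (ι k))), ∀ k' ∉ Set.range ι, update S (ι k) x k' = S₀ k' := by
    intro S hS k x k' hk'
    rw [update_of_ne (fun h => hk' ⟨k, h.symm⟩), hS k' hk']
  induction q generalizing v S with
  | push k f q ih =>
    simp only [liftStmt, TM2.stepAux, state.get_set, ← update_comp_eq_of_injective' S hι]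
    exact ih _ (update_frame hS _ _)
  | pop k f q ih =>
    simp only [liftStmt, TM2.stepAux, state.get_set, state.set_set,
      ← update_comp_eq_of_injective' S hι]
    exact ih _ (update_frame hS _ _)
  | peek k f q ih | load f q ih =>
    simp only [liftStmt, TM2.stepAux, state.get_set, state.set_set]
    exact ih _ hS
  | branch f q₁ q₂ ih₁ ih₂ =>
    simp only [liftStmt, TM2.stepAux, state.get_set]
    cases f v
    · exact ih₂ v hS
    · exact ih₁ v hS
  | goto f => exact ⟨by simp [liftStmt, TM2.stepAux, state.get_set], rfl, rfl, hS⟩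
  | halt =>
    rw [liftStmt, stepAux_continueAt]
    exact ⟨rfl, rfl, rfl, hS⟩

theorem Represents.exists_step {M₁ : Λ₁ → TM2.Stmt (fun k => Γ (ι k)) Λ₁ σ₁}
    {M : Λ → TM2.Stmt Γ Λ σ} (hι : Injective ι)
    (hM : ∀ l, M (lab l) = liftStmt ι state lab exit (M₁ l))
    {c c' : TM2.Cfg (fun k => Γ (ι k)) Λ₁ σ₁} {d : TM2.Cfg Γ Λ σ}
    (h : Represents ι state lab exit v₀ S₀ c d) (hc : TM2.step M₁ c = some c') :
    ∃ d', Represents ι state lab exit v₀ S₀ c' d' ∧ TM2.step M d = some d' := by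
  obtain ⟨l | l, v, S₁⟩ := c
  · cases hc
  · obtain ⟨_, _, S⟩ := d
    obtain ⟨hl, hv, hS₁, hS⟩ := h
    dsimp only at hl hv hS₁ hS
    subst hl hv hS₁
    cases hc
    exact ⟨_, represents_stepAux_liftStmt hι (M₁ l) v hS, by
      rw [← hM]
      rfl⟩

theorem Represents.exists_reachesIn {M₁ : Λ₁ → TM2.Stmt (fun k => Γ (ι k)) Λ₁ σ₁}
    {M : Λ → TM2.Stmt Γ Λ σ} (hι : Injective ι)
    (hM : ∀ l, M (lab l) = liftStmt ι state lab exit (M₁ l))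
    {c c' : TM2.Cfg (fun k => Γ (ι k)) Λ₁ σ₁} {d : TM2.Cfg Γ Λ σ} {t : ℕ}
    (h : Represents ι state lab exit v₀ S₀ c d) (hc : ReachesIn (TM2.step M₁) c c' t) :
    ∃ d', Represents ι state lab exit v₀ S₀ c' d' ∧ ReachesIn (TM2.step M) d d' t :=
  hc.exists_of_simulation (fun _ _ _ h hc => h.exists_step hι hM hc) h

theorem represents_update_iff (hι : Injective ι) {l : Option Λ₁} {v : σ₁} {k : K₁}
    {x : List (Γ (ι k))} {d : TM2.Cfg Γ Λ σ} :
    Represents ι state lab exit v₀ (fun _ => []) ⟨l, v, update (fun _ => []) k x⟩ d ↔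
      d = ⟨l.elim exit fun l => some (lab l), state.set v v₀, update (fun _ => []) (ι k) x⟩ := by
  have comp_update : (fun k' => update (fun k => ([] : List (Γ k))) (ι k) x (ι k')) =
      (update (fun _ => []) k x : ∀ k, List (Γ (ι k))) :=
    update_comp_eq_of_injective' (fun k => ([] : List (Γ k))) hι k x
  constructor
  · rintro ⟨hl, hv, hS, hS₀⟩
    obtain ⟨l', v', S⟩ := d
    dsimp only at hl hv hS hS₀
    subst hl hv
    congr 1
    funext k'
    by_cases hk' : k' ∈ Set.range ι
    · obtain ⟨k', rfl⟩ := hk'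
      exact congrFun (hS.trans comp_update.symm) k'
    · rw [hS₀ k' hk', update_of_ne fun h => hk' ⟨k, h.symm⟩]
  · rintro rfl
    exact ⟨rfl, rfl, comp_update, fun k' hk' =>
      update_of_ne (fun h => hk' ⟨k, h.symm⟩) x fun _ => []⟩

theorem ReachesIn.lift {M₁ : Λ₁ → TM2.Stmt (fun k => Γ (ι k)) Λ₁ σ₁} (hι : Injective ι)
    (hM : ∀ l, M (lab l) = liftStmt ι state lab exit (M₁ l)) (v₀ : σ) {l l' : Option Λ₁}
    {v v' : σ₁} {k k' : K₁} {x : List (Γ (ι k))} {y : List (Γ (ι k'))} {t : ℕ}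
    (h : ReachesIn (TM2.step M₁) ⟨l, v, update (fun _ => []) k x⟩
      ⟨l', v', update (fun _ => []) k' y⟩ t) :
    ReachesIn (TM2.step M)
      ⟨l.elim exit fun l => some (lab l), state.set v v₀, update (fun _ => []) (ι k) x⟩
      ⟨l'.elim exit fun l => some (lab l), state.set v' v₀, update (fun _ => []) (ι k') y⟩ t := by
  obtain ⟨d, hd, hreach⟩ :=
    ((represents_update_iff hι (v₀ := v₀)).2 rfl).exists_reachesIn hι hM h
  rwa [(represents_update_iff hι).1 hd] at hreach

end Lift

section Outputs

variable {T : FinTM2}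

theorem initList_eq (l : List (T.Γ T.k₀)) :
    initList T l = ⟨some T.main, T.initialState, update (fun _ => []) T.k₀ l⟩ := by
  unfold initList
  congr 1
  funext k
  by_cases h : k = T.k₀
  · subst h
    simp
  · simp [h]

theorem haltList_eq (l : List (T.Γ T.k₁)) :
    haltList T l = ⟨none, T.initialState, update (fun _ => []) T.k₁ l⟩ := by
  unfold haltList
  congr 1
  funext k
  by_cases h : k = T.k₁
  · subst h
    simp
  · simp [h]

theorem nonempty_outputsInTime_iff {l : List (T.Γ T.k₀)} {l' : List (T.Γ T.k₁)} {t : ℕ} :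
    Nonempty (TM2OutputsInTime T l (some l') t) ↔
      ReachesIn (TM2.step T.m) ⟨some T.main, T.initialState, update (fun _ => []) T.k₀ l⟩
        ⟨none, T.initialState, update (fun _ => []) T.k₁ l'⟩ t := by
  rw [← initList_eq, ← haltList_eq]
  rfl

end Outputs

section Comp

attribute [local instance] FinTM2.kFin FinTM2.ΛFin FinTM2.σFin FinTM2.Γk₀Fin

variable {Γ₀ Γ₁ Γ₂ : Type}

/-- The alphabets of the stacks of the composition of two machines: those of the machines, and an
auxiliary stack with the alphabet `Γ₁`. -/
abbrev CompAlphabet (T₁ : TM2ComputableAux Γ₀ Γ₁) (T₂ : TM2ComputableAux Γ₁ Γ₂) :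
    Option (T₁.tm.K ⊕ T₂.tm.K) → Type
  | none => Γ₁
  | some (.inl k) => T₁.tm.Γ k
  | some (.inr k) => T₂.tm.Γ k

/-- The labels of the composition of two machines: those of the machines, and the loops that move
the output of the first one to the auxiliary stack (which reverses it) and from there to the input
stack of the second one. -/
inductive CompLabel (Λ₁ Λ₂ : Type)
  | first (l : Λ₁)
  | unload
  | reload
  | second (l : Λ₂)
  deriving Fintype

/-- The machine that runs `T₁`, moves the output to the input stack of `T₂`, and runs `T₂`. -/
def comp [Fintype Γ₁] [Inhabited Γ₁] (T₁ : TM2ComputableAux Γ₀ Γ₁)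
    (T₂ : TM2ComputableAux Γ₁ Γ₂) : TM2ComputableAux Γ₀ Γ₂ where
  tm :=
    { K := Option (T₁.tm.K ⊕ T₂.tm.K)
      k₀ := some (.inl T₁.tm.k₀)
      k₁ := some (.inr T₂.tm.k₁)
      Γ := CompAlphabet T₁ T₂
      Λ := CompLabel T₁.tm.Λ T₂.tm.Λ
      main := .first T₁.tm.main
      σ := T₁.tm.σ × T₂.tm.σ × Option Γ₁
      initialState := (T₁.tm.initialState, T₂.tm.initialState, none)
      Γk₀Fin := inferInstanceAs (Fintype (T₁.tm.Γ T₁.tm.k₀))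
      m := fun
        | .first l =>
          liftStmt (fun k => some (.inl k)) ⟨fun v => v.1, fun x v => (x, v.2), fun _ _ => rfl,
            fun _ _ _ => rfl⟩ .first (some .unload) (T₁.tm.m l)
        | .unload =>
          moveStmt ⟨fun v => v.2.2, fun x v => (v.1, v.2.1, x), fun _ _ => rfl, fun _ _ _ => rfl⟩
            (some (.inl T₁.tm.k₁)) none T₁.outputAlphabet id .unload (some .reload)
        | .reload =>
          moveStmt ⟨fun v => v.2.2, fun x v => (v.1, v.2.1, x), fun _ _ => rfl, fun _ _ _ => rfl⟩
            none (some (.inr T₂.tm.k₀)) id T₂.inputAlphabet.symm .reload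
            (some (.second T₂.tm.main))
        | .second l =>
          liftStmt (fun k => some (.inr k)) ⟨fun v => v.2.1, fun x v => (v.1, x, v.2.2),
            fun _ _ => rfl, fun _ _ _ => rfl⟩ .second none (T₂.tm.m l) }
  inputAlphabet := T₁.inputAlphabet
  outputAlphabet := T₂.outputAlphabet

theorem outputsInTime_comp [Fintype Γ₁] [Inhabited Γ₁] {T₁ : TM2ComputableAux Γ₀ Γ₁}
    {T₂ : TM2ComputableAux Γ₁ Γ₂} {x : List Γ₀} {y : List Γ₁} {z : List Γ₂} {s t : ℕ}
    (h₁ : Nonempty (TM2OutputsInTime T₁.tm (x.map T₁.inputAlphabet.symm)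
      (some (y.map T₁.outputAlphabet.symm)) s))
    (h₂ : Nonempty (TM2OutputsInTime T₂.tm (y.map T₂.inputAlphabet.symm)
      (some (z.map T₂.outputAlphabet.symm)) t)) :
    Nonempty (TM2OutputsInTime (comp T₁ T₂).tm (x.map (comp T₁ T₂).inputAlphabet.symm)
      (some (z.map (comp T₁ T₂).outputAlphabet.symm)) (s + (2 * y.length + 2) + t)) := by
  rw [nonempty_outputsInTime_iff] at h₁ h₂ ⊢
  let v := (comp T₁ T₂).tm.initialState
  have unload_eq : ((y.map T₁.outputAlphabet.symm).map fun x => id (T₁.outputAlphabet x)).reverse =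
      y.reverse := by
    simp
  have reload_eq : (y.reverse.map fun x => T₂.inputAlphabet.symm (id x)).reverse =
      y.map T₂.inputAlphabet.symm := by
    simp
  have run_first := h₁.lift (M := (comp T₁ T₂).tm.m) (lab := .first) (exit := some .unload)
    ((Option.some_injective _).comp Sum.inl_injective) (fun _ => rfl) v
  have run_unload := reachesIn_moveStmt_update (M := (comp T₁ T₂).tm.m) (self := .unload)
    (Option.some_ne_none _) rfl v unload_eq
  have run_reload := reachesIn_moveStmt_update (M := (comp T₁ T₂).tm.m) (self := .reload)
    (Option.some_ne_none _).symm rfl v reload_eq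
  have run_second := h₂.lift (M := (comp T₁ T₂).tm.m) (lab := .second) (exit := none)
    ((Option.some_injective _).comp Sum.inr_injective) (fun _ => rfl) v
  refine (((run_first.trans run_unload).trans run_reload).trans run_second).mono ?_
  change s + ((y.map T₁.outputAlphabet.symm).length + 1) + (y.reverse.length + 1) + t ≤ _
  rw [List.length_map, List.length_reverse]
  omega

end Comp

section Growth

variable {K Λ σ : Type*} {Γ : K → Type*}

/-- The number of `push` instructions of a statement, which bounds the growth of the stacks. -/
def pushCount : TM2.Stmt Γ Λ σ → ℕ
  | .push _ _ q => pushCount q + 1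
  | .peek _ _ q => pushCount q
  | .pop _ _ q => pushCount q
  | .load _ q => pushCount q
  | .branch _ q₁ q₂ => pushCount q₁ + pushCount q₂
  | .goto _ => 0
  | .halt => 0

variable [DecidableEq K]

theorem length_stk_stepAux_le (q : TM2.Stmt Γ Λ σ) (v : σ) (S : ∀ k, List (Γ k)) (k : K) :
    ((TM2.stepAux q v S).stk k).length ≤ (S k).length + pushCount q := by
  induction q generalizing v S with
  | push k' f q ih =>
    refine (ih ..).trans ?_
    obtain rfl | hk := eq_or_ne k k'
    · simp only [update_self, List.length_cons, pushCount]
      omega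
    · simp only [update_of_ne hk, pushCount]
      omega
  | pop k' f q ih =>
    refine (ih ..).trans (Nat.add_le_add_right ?_ _)
    obtain rfl | hk := eq_or_ne k k'
    · simp
    · rw [update_of_ne hk]
  | peek _ _ _ ih | load _ _ ih => exact ih ..
  | branch f q₁ q₂ ih₁ ih₂ =>
    simp only [TM2.stepAux, pushCount]
    cases f v
    · exact (ih₂ v S).trans (by omega)
    · exact (ih₁ v S).trans (by omega)
  | goto | halt => exact le_rfl

theorem exists_length_output_le (T : FinTM2) : ∃ C : ℕ, ∀ (l : List (T.Γ T.k₀))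
    (l' : List (T.Γ T.k₁)) (t : ℕ), Nonempty (TM2OutputsInTime T l (some l') t) →
      l'.length ≤ l.length + C * t := by
  let := T.ΛFin
  refine ⟨Finset.univ.sup fun l => pushCount (T.m l), fun l l' t h => ?_⟩
  rw [nonempty_outputsInTime_iff] at h
  have growth : ∀ ⦃c d⦄, TM2.step T.m c = some d → (d.stk T.k₁).length ≤ (c.stk T.k₁).length +
      Finset.univ.sup fun l => pushCount (T.m l) := by
    rintro ⟨_ | l, v, S⟩ _ ⟨⟩
    exact (length_stk_stepAux_le ..).trans
      (Nat.add_le_add_left (Finset.le_sup (f := fun l => pushCount (T.m l)) (Finset.mem_univ l)) _)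
  have final_le := h.measure_le growth
  have initial_le : ∀ k, (update (fun k => ([] : List (T.Γ k))) T.k₀ l k).length ≤ l.length := by
    intro k
    obtain rfl | hk := eq_or_ne k T.k₀
    · rw [update_self]
    · simp [update_of_ne hk]
  simp only [update_self] at final_le
  exact final_le.trans (Nat.add_le_add_right (initial_le T.k₁) _)

theorem exists_length_le_eval {α β αΓ βΓ : Type} {ea : α → List αΓ} {eb : β → List βΓ} {g : α → β}
    (hg : TM2ComputableInPolyTime ea eb g) :
    ∃ q : Polynomial ℕ, ∀ x, (eb (g x)).length ≤ q.eval (ea x).length := by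
  obtain ⟨C, hC⟩ := exists_length_output_le hg.tm
  exact ⟨.X + .C C * hg.time, fun x => by simpa using hC _ _ _ ⟨hg.outputsFun x⟩⟩

end Growth

end StackMachine

theorem exists_isLittleO_forall_abs_le {f : ℕ → ℝ}
    (hf : f =o[Filter.atTop] (fun n : ℕ => (n : ℝ))) (a b : ℕ) :
    ∃ F : ℕ → ℝ, F =o[Filter.atTop] (fun n : ℕ => (n : ℝ)) ∧
      ∀ k n, k ≤ a * n + b → |f k| ≤ F n := by
  refine ⟨fun n => partialSups (fun k => |f k|) (a * n + b), ?_, fun k n hk =>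
    le_partialSups_of_le (fun k => |f k|) hk⟩
  refine Asymptotics.isLittleO_iff.2 fun ε hε => ?_
  let δ := ε / (2 * (a + 1))
  have hδ : 0 < δ := by positivity
  obtain ⟨N, hN⟩ := Filter.eventually_atTop.1 (Asymptotics.isLittleO_iff.1 hf hδ)
  let C := partialSups (fun k => |f k|) N
  have bound : ∀ k : ℕ, partialSups (fun k => |f k|) k ≤ C + δ * k := by
    refine fun k => partialSups_le _ _ _ fun j hj => ?_
    have hjk : δ * j ≤ δ * k := by gcongr
    rcases le_total j N with hjN | hjN
    · exact (le_partialSups_of_le (fun k => |f k|) hjN).trans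
        (le_add_of_nonneg_right (by positivity))
    · have hj : |f j| ≤ δ * j := by simpa using hN j hjN
      have hC : 0 ≤ C := (abs_nonneg _).trans (le_partialSups (fun k => |f k|) N)
      linarith
  filter_upwards [Filter.eventually_ge_atTop ⌈2 * (C + δ * b) / ε⌉₊] with n hn
  have hn : 2 * (C + δ * b) ≤ ε * n := by
    rw [mul_comm ε]
    exact (div_le_iff₀ hε).1 (Nat.ceil_le.1 hn)
  have hδa : 2 * (δ * (a * n)) ≤ ε * n := by
    have : 2 * (δ * (a + 1)) = ε := by simp only [δ]; field_simp
    have : 0 ≤ δ * n := by positivity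
    nlinarith
  have h := bound (a * n + b)
  push_cast at h
  rw [Real.norm_eq_abs, abs_of_nonneg ((abs_nonneg _).trans
    (le_partialSups (fun k => |f k|) _)), Real.norm_natCast]
  linarith

theorem monotone_polynomial_eval {R : Type*} [Semiring R] [PartialOrder R] [IsOrderedRing R]
    [CanonicallyOrderedAdd R] (p : Polynomial R) : Monotone fun x => p.eval x := by
  intro x y h
  simp only [Polynomial.eval_eq_sum_range]
  gcongr

namespace DecidableInSubexpTime

open StackMachine in
theorem of_polyTimeReduction {α β : Type} {encα : α → List Bool} {κα : α → ℕ} {Pα : α → Prop}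
    {encβ : β → List Bool} {κβ : β → ℕ} {Pβ : β → Prop} {g : α → β}
    (hg : Turing.TM2ComputableInPolyTime encα encβ g) {a b : ℕ} (hκ : ∀ x, κβ (g x) ≤ a * κα x + b)
    (hP : ∀ x, Pβ (g x) ↔ Pα x) (h : DecidableInSubexpTime encβ κβ Pβ) :
    DecidableInSubexpTime encα κα Pα := by
  classical
  obtain ⟨T, f, p, hf, hT⟩ := h
  obtain ⟨F, hF, hfF⟩ := exists_isLittleO_forall_abs_le hf a b
  obtain ⟨q, hq⟩ := exists_length_le_eval hg
  refine ⟨comp hg.toTM2ComputableAux T, F, hg.time + (2 * q + 2) + p.comp q, hF, fun x => ?_⟩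
  obtain ⟨t, ht, hout⟩ := hT (g x)
  refine ⟨hg.time.eval (encα x).length + (2 * (encβ (g x)).length + 2) + t, ?_, ?_⟩
  · have hf_le := hfF _ _ (hκ x)
    have pow_le : (2 : ℝ) ^ f (κβ (g x)) ≤ 2 ^ F (κα x) :=
      Real.rpow_le_rpow_of_exponent_le one_le_two ((le_abs_self _).trans hf_le)
    have one_le_pow : (1 : ℝ) ≤ 2 ^ F (κα x) :=
      Real.one_le_rpow one_le_two ((abs_nonneg _).trans hf_le)
    rw [Polynomial.eval_add, Polynomial.eval_comp, Nat.cast_add _ t,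
      Nat.cast_add _ (Polynomial.eval _ p), mul_add]
    refine add_le_add (le_trans ?_ (le_mul_of_one_le_left (Nat.cast_nonneg _) one_le_pow))
      (ht.trans ?_)
    · simp only [Polynomial.eval_add, Polynomial.eval_mul, Polynomial.eval_ofNat]
      gcongr
      exact hq x
    · have eval_le := monotone_polynomial_eval p (hq x)
      dsimp only at eval_le
      gcongr
  · rw [decide_eq_decide.2 (hP x)] at hout
    exact outputsInTime_comp ⟨hg.outputsFun x⟩ hout

end DecidableInSubexpTime

/-- Programs operating on stacks of bits named by `K`, from which machines are compiled. The bits of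
`push k bs` are pushed from left to right; `ite` and `loop` pop the bit that they test, where the
empty stack counts as `false`; `move src dst` pops all bits of `src` and pushes them on `dst`. -/
inductive StackProg (K : Type)
  | push (k : K) (bs : List Bool)
  | move (src dst : K)
  | seq (p q : StackProg K)
  | ite (k : K) (p q : StackProg K)
  | loop (k : K) (p : StackProg K)

namespace StackProg

open StackMachine Turing Function

infixr:60 ";;" => StackProg.seq

variable {K : Type} [DecidableEq K]

/-- `Exec p s s' t`: started with the stacks `s`, the program `p` ends with the stacks `s'`, in time
at most `t`. -/
inductive Exec : StackProg K → (K → List Bool) → (K → List Bool) → ℕ → Prop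
  | push (k bs s) : Exec (push k bs) s (update s k (bs.reverse ++ s k)) (bs.length + 1)
  | move {src dst} (hne : src ≠ dst) (s) : Exec (move src dst) s
      (update (update s src []) dst ((s src).reverse ++ s dst)) ((s src).length + 1)
  | seq {p q s s₁ s₂ t₁ t₂} : Exec p s s₁ t₁ → Exec q s₁ s₂ t₂ → Exec (p ;; q) s s₂ (t₁ + t₂)
  | ite_true {k p q s s' t l} : s k = true :: l → Exec p (update s k l) s' t →
      Exec (ite k p q) s s' (t + 1)
  | ite_false {k p q s s' t} : (s k).head? ≠ some true → Exec q (update s k (s k).tail) s' t →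
      Exec (ite k p q) s s' (t + 1)
  | loop_exit {k p s} : (s k).head? ≠ some true →
      Exec (loop k p) s (update s k (s k).tail) 1
  | loop_step {k p s s₁ s₂ t₁ t₂ l} : s k = true :: l → Exec p (update s k l) s₁ t₁ →
      Exec (loop k p) s₁ s₂ t₂ → Exec (loop k p) s s₂ (t₁ + t₂ + 1)
  | mono {p s s' t t'} : Exec p s s' t → t ≤ t' → Exec p s s' t'

theorem Exec.length_le {p : StackProg K} {s s' : K → List Bool} {t : ℕ} (h : Exec p s s' t)
    (k : K) : (s' k).length ≤ (s k).length + t := by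
  induction h <;> grind

section Compile

variable {Λ : Type}

/-- The control points of a program. -/
@[reducible] def Label : StackProg K → Type
  | push _ _ => Unit
  | move _ _ => Unit
  | seq p q => p.Label ⊕ q.Label
  | ite _ p q => Option (p.Label ⊕ q.Label)
  | loop _ p => Option p.Label

instance fintypeLabel : (p : StackProg K) → Fintype p.Label
  | push _ _ => inferInstanceAs (Fintype Unit)
  | move _ _ => inferInstanceAs (Fintype Unit)
  | seq p q =>
    letI := fintypeLabel p
    letI := fintypeLabel q
    inferInstanceAs (Fintype (p.Label ⊕ q.Label))
  | ite _ p q =>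
    letI := fintypeLabel p
    letI := fintypeLabel q
    inferInstanceAs (Fintype (Option (p.Label ⊕ q.Label)))
  | loop _ p =>
    letI := fintypeLabel p
    inferInstanceAs (Fintype (Option p.Label))

/-- The control point at which a program starts. -/
def entry : (p : StackProg K) → p.Label
  | push _ _ => ()
  | move _ _ => ()
  | seq p _ => .inl p.entry
  | ite _ _ _ => none
  | loop _ _ => none

/-- Push the bits of a list on a stack, one after the other, and continue with `q`. -/
def pushStmt (k : K) (bs : List Bool) (q : TM2.Stmt (fun _ : K => Bool) Λ (Option Bool)) :
    TM2.Stmt (fun _ : K => Bool) Λ (Option Bool) :=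
  bs.foldr (fun b q => .push k (fun _ => b) q) q

/-- Pop a bit, and continue with `q₁` if it is `true`, and with `q₂` otherwise. The internal state,
which is `none` between two instructions of a program, holds the bit until it has been tested. -/
def popStmt (k : K) (q₁ q₂ : TM2.Stmt (fun _ : K => Bool) Λ (Option Bool)) :
    TM2.Stmt (fun _ : K => Bool) Λ (Option Bool) :=
  .pop k (fun _ b => b)
    (.branch (fun v => v == some true) (.load (fun _ => none) q₁) (.load (fun _ => none) q₂))

/-- The statement at a control point of a program; `lab` places the control points in the set of
labels of the whole machine, and the program continues at the label `exit`, or halts. -/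
def code : (p : StackProg K) → (lab : p.Label → Λ) → (exit : Option Λ) → p.Label →
    TM2.Stmt (fun _ : K => Bool) Λ (Option Bool)
  | push k bs, _, exit, _ => pushStmt k bs (continueAt exit)
  | move src dst, lab, exit, _ =>
    moveStmt ⟨id, fun x _ => x, fun _ _ => rfl, fun _ _ _ => rfl⟩ src dst id id (lab ()) exit
  | seq p q, lab, _, .inl l => code p (fun l => lab (.inl l)) (some (lab (.inr q.entry))) l
  | seq _ q, lab, exit, .inr l => code q (fun l => lab (.inr l)) exit l
  | ite k p q, lab, _, none =>
    popStmt k (.goto fun _ => lab (some (.inl p.entry))) (.goto fun _ => lab (some (.inr q.entry)))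
  | ite _ p _, lab, exit, some (.inl l) => code p (fun l => lab (some (.inl l))) exit l
  | ite _ _ q, lab, exit, some (.inr l) => code q (fun l => lab (some (.inr l))) exit l
  | loop k p, lab, exit, none =>
    popStmt k (.goto fun _ => lab (some p.entry)) (continueAt exit)
  | loop _ p, lab, _, some l => code p (fun l => lab (some l)) (some (lab none)) l

theorem stepAux_pushStmt (k : K) (bs : List Bool)
    (q : TM2.Stmt (fun _ : K => Bool) Λ (Option Bool)) (v : Option Bool) (s : K → List Bool) :
    TM2.stepAux (pushStmt k bs q) v s = TM2.stepAux q v (update s k (bs.reverse ++ s k)) := by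
  induction bs generalizing s with
  | nil => simp [pushStmt]
  | cons b bs ih => exact (ih _).trans (by simp)

theorem stepAux_popStmt_true {k : K} {s : K → List Bool} {l : List Bool} (hs : s k = true :: l)
    (q₁ q₂ : TM2.Stmt (fun _ : K => Bool) Λ (Option Bool)) (v : Option Bool) :
    TM2.stepAux (popStmt k q₁ q₂) v s = TM2.stepAux q₁ none (update s k l) := by
  simp [popStmt, TM2.stepAux, hs]

theorem stepAux_popStmt_false {k : K} {s : K → List Bool} (hs : (s k).head? ≠ some true)
    (q₁ q₂ : TM2.Stmt (fun _ : K => Bool) Λ (Option Bool)) (v : Option Bool) :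
    TM2.stepAux (popStmt k q₁ q₂) v s = TM2.stepAux q₂ none (update s k (s k).tail) := by
  simp [popStmt, TM2.stepAux, beq_false_of_ne hs]

theorem Exec.reachesIn {p : StackProg K} {s s' : K → List Bool} {t : ℕ} (h : Exec p s s' t)
    {M : Λ → TM2.Stmt (fun _ : K => Bool) Λ (Option Bool)} {lab : p.Label → Λ} {exit : Option Λ}
    (hM : ∀ l, M (lab l) = code p lab exit l) :
    ReachesIn (TM2.step M) ⟨some (lab p.entry), none, s⟩ ⟨exit, none, s'⟩ t := by
  have step_eq (l : p.Label) (s : K → List Bool) : TM2.step M ⟨some (lab l), none, s⟩ =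
      some (TM2.stepAux (code p lab exit l) none s) := by
    rw [← hM]
    rfl
  induction h generalizing exit with
  | push k bs s =>
    refine (ReachesIn.single ((step_eq _ _).trans ?_)).mono (Nat.le_add_left 1 _)
    rw [code, stepAux_pushStmt, stepAux_continueAt]
  | move hne s => simpa using reachesIn_moveStmt hne (hM ()) none (S := s) rfl
  | @seq p q s s₁ s₂ t₁ t₂ _ _ ih₁ ih₂ =>
    exact (ih₁ (fun l => hM (.inl l)) fun l => step_eq (.inl l)).trans
      (ih₂ (fun l => hM (.inr l)) fun l => step_eq (.inr l))
  | @ite_true k p q s s' t l hs _ ih =>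
    refine add_comm 1 t ▸ ReachesIn.trans (.single ((step_eq _ _).trans ?_))
      (ih (fun l => hM (some (.inl l))) fun l => step_eq (some (.inl l)))
    rw [entry, code, stepAux_popStmt_true hs]
    rfl
  | @ite_false k p q s s' t hs _ ih =>
    refine add_comm 1 t ▸ ReachesIn.trans (.single ((step_eq _ _).trans ?_))
      (ih (fun l => hM (some (.inr l))) fun l => step_eq (some (.inr l)))
    rw [entry, code, stepAux_popStmt_false hs]
    rfl
  | loop_exit hs =>
    refine .single ((step_eq _ _).trans ?_)
    rw [entry, code, stepAux_popStmt_false hs, stepAux_continueAt]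
  | @loop_step k p s s₁ s₂ t₁ t₂ l hs _ _ ih₁ ih₂ =>
    refine add_comm 1 (t₁ + t₂) ▸ ReachesIn.trans (.single ((step_eq _ _).trans ?_))
      ((ih₁ (fun l => hM (some l)) fun l => step_eq (some l)).trans (ih₂ hM step_eq))
    rw [entry, code, stepAux_popStmt_true hs]
    rfl
  | mono _ ht ih => exact (ih hM step_eq).mono ht

variable [Fintype K]

/-- The machine that runs a program, with the input stack `k₀` and the output stack `k₁`. -/
def toTM2 (p : StackProg K) (k₀ k₁ : K) : TM2ComputableAux Bool Bool where
  tm :=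
    { K := K
      k₀ := k₀
      k₁ := k₁
      Γ := fun _ => Bool
      Λ := p.Label
      main := p.entry
      σ := Option Bool
      initialState := none
      Γk₀Fin := inferInstanceAs (Fintype Bool)
      m := code p id none }
  inputAlphabet := .refl Bool
  outputAlphabet := .refl Bool

theorem outputsInTime_toTM2 {p : StackProg K} {k₀ k₁ : K} {l l' : List Bool} {t : ℕ}
    (h : Exec p (update (fun _ => []) k₀ l) (update (fun _ => []) k₁ l') t) :
    Nonempty (TM2OutputsInTime (p.toTM2 k₀ k₁).tm (l.map (p.toTM2 k₀ k₁).inputAlphabet.symm)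
      (some (l'.map (p.toTM2 k₀ k₁).outputAlphabet.symm)) t) := by
  rw [nonempty_outputsInTime_iff]
  change ReachesIn (TM2.step (code p id none))
    ⟨some (id p.entry), none, update (fun _ => []) k₀ (l.map id)⟩
    ⟨none, none, update (fun _ => []) k₁ (l'.map id)⟩ t
  rw [List.map_id, List.map_id]
  exact h.reachesIn fun _ => rfl

/-- A function computed by a program in polynomial time is computable in polynomial time. -/
noncomputable def computableInPolyTime {α β : Type} {ea : α → List Bool} {eb : β → List Bool}
    {g : α → β} (p : StackProg K) (k₀ k₁ : K) (time : Polynomial ℕ)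
    (h : ∀ x, Exec p (update (fun _ => []) k₀ (ea x)) (update (fun _ => []) k₁ (eb (g x)))
      (time.eval (ea x).length)) : TM2ComputableInPolyTime ea eb g where
  toTM2ComputableAux := p.toTM2 k₀ k₁
  time := time
  outputsFun x := (outputsInTime_toTM2 (h x)).some

end Compile

section Writes

variable {p q : StackProg K} {k src dst : K} {s s' : K → List Bool} {bs bs' : List Bool} {t t' : ℕ}

/-- Whatever the stack `k` contains, the program `p`, started with the stacks `s` otherwise, pushes
the bits of `bs` on the stack `k` from left to right, in time at most `t`, and leaves the other
stacks as they were. -/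
def Writes (p : StackProg K) (k : K) (s : K → List Bool) (bs : List Bool) (t : ℕ) : Prop :=
  ∀ r, Exec p (update s k r) (update s k (bs.reverse ++ r)) t

theorem Exec.congr (h : Exec p s s' t) {u u' : K → List Bool} (hu : s = u) (hu' : s' = u')
    (ht : t ≤ t') : Exec p u u' t' := by
  subst hu hu'
  exact h.mono ht

theorem Writes.exec (h : Writes p k s bs t) : Exec p s (update s k (bs.reverse ++ s k)) t := by
  simpa using h (s k)

theorem Writes.length_le (h : Writes p k s bs t) : bs.length ≤ t := by
  simpa using (h []).length_le k

theorem Writes.mono (h : Writes p k s bs t) (ht : t ≤ t') : Writes p k s bs t' :=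
  fun r => (h r).mono ht

theorem Writes.seq (hp : Writes p k s bs t) (hq : Writes q k s bs' t') :
    Writes (p ;; q) k s (bs ++ bs') (t + t') := by
  intro r
  simpa using (hp r).seq (hq _)

theorem writes_push (k : K) (bs : List Bool) (s : K → List Bool) :
    Writes (push k bs) k s bs (bs.length + 1) := by
  intro r
  simpa using Exec.push k bs (update s k r)

theorem Exec.loop_writes (hne : k ≠ dst) {bits : ℕ → List Bool} {l : List Bool}
    (hl : l.head? ≠ some true) {j : ℕ}
    (h : ∀ i < j, Writes p dst (update s k (List.replicate i true ++ l)) (bits i) t)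
    (r : List Bool) :
    Exec (loop k p) (update (update s k (List.replicate j true ++ l)) dst r)
      (update (update s k l.tail) dst (((List.range j).reverse.flatMap bits).reverse ++ r))
      (j * (t + 1) + 1) := by
  induction j generalizing r with
  | zero =>
    refine (Exec.loop_exit (by simpa [hne] using hl)).congr rfl ?_ (by omega)
    simp [hne, update_comm hne]
  | succ j ih =>
    have rest := ih (fun i hi => h i (by omega)) ((bits j).reverse ++ r)
    refine (Exec.loop_step (l := List.replicate j true ++ l) (by simp [hne, List.replicate_succ])
      ((h j (by omega) r).congr ?_ rfl le_rfl) rest).congr rfl ?_ (by ring_nf; omega)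
    · simp [update_comm hne]
    · simp [List.range_succ]

/-- Push the bits of the counter `src` on the counter `dst`, and pop the bit that ends `src`. -/
def addTo (src dst : K) : StackProg K :=
  loop src (push dst [true])

theorem exec_addTo (hne : src ≠ dst) {j : ℕ} {l : List Bool}
    (hs : s src = List.replicate j true ++ l) (hl : l.head? ≠ some true) :
    Exec (addTo src dst) s
      (update (update s src l.tail) dst (List.replicate j true ++ s dst)) (j * 3 + 1) := by
  refine (Exec.loop_writes (s := s) hne hl (j := j) (bits := fun _ => [true])
    (fun _ _ => writes_push dst [true] _) (s dst)).congr ?_ ?_ le_rfl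
  · rw [← hs, update_eq_self, update_eq_self]
  · simp [List.flatMap_def]

/-- Reset the counter `k` to zero. -/
def clear (k : K) : StackProg K :=
  loop k (push k [])

theorem exec_clear {j : ℕ} (hs : s k = List.replicate j true) :
    Exec (clear k) s (update s k []) (j * 2 + 1) := by
  induction j generalizing s with
  | zero => exact (Exec.loop_exit (by simp [hs])).congr rfl (by simp [hs]) (by omega)
  | succ j ih =>
    refine (Exec.loop_step hs (Exec.push ..) (ih (by simp))).congr rfl (by simp) ?_
    rw [List.length_nil]
    omega

/-- Push `a` times `true` on `dst` for every bit of the counter `src`, which is restored with the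
help of the empty stack `aux`. -/
def copy (src aux dst : K) (a : ℕ) : StackProg K :=
  loop src (push aux [true] ;; push dst (List.replicate a true)) ;; addTo aux src

theorem writes_copy {aux : K} (h₁ : src ≠ aux) (h₂ : src ≠ dst) (h₃ : aux ≠ dst) (a : ℕ) {j : ℕ}
    (hs : s src = List.replicate j true) (ha : s aux = []) :
    Writes (copy src aux dst a) dst s (List.replicate (a * j) true) (j * (a + 7) + 2) := by
  have fill {i : ℕ} {u : K → List Bool} (hu : u src = List.replicate i true) :
      Exec (loop src (push aux [true] ;; push dst (List.replicate a true))) u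
        (update (update (update u src []) aux (List.replicate i true ++ u aux)) dst
          (List.replicate (a * i) true ++ u dst)) (i * (a + 4) + 1) := by
    induction i generalizing u with
    | zero =>
      refine (Exec.loop_exit (by simp [hu])).congr rfl ?_ (by omega)
      funext x
      by_cases x = src <;> by_cases x = aux <;> by_cases x = dst <;> simp_all
    | succ i ih =>
      refine (Exec.loop_step hu ((Exec.push ..).seq (Exec.push ..)) (ih ?_)).congr rfl ?_ ?_
      · simp [h₁, h₂]
      · funext x
        by_cases x = src <;> by_cases x = aux <;> by_cases x = dst <;>
          simp_all [Nat.mul_succ, List.replicate_succ', List.replicate_add,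
            -List.replicate_append_replicate]
      · simp only [List.length_replicate, List.length_singleton]
        ring_nf
        omega
  intro r
  refine ((fill (i := j) (by simp [h₂, hs])).seq
    (exec_addTo h₁.symm (j := j) (l := []) ?_ ?_)).congr rfl ?_ ?_
  · simp [h₃, ha]
  · simp
  · funext x
    by_cases x = src <;> by_cases x = aux <;> by_cases x = dst <;> simp_all
  · ring_nf
    omega

/-- Write `a * j + d`, where `j` is the value of the counter `src`, on the stack `dst`, with the
help of the empty stack `aux`. -/
def writeUnary (src aux dst : K) (a d : ℕ) : StackProg K :=
  copy src aux dst a ;; push dst (List.replicate d true ++ [false])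

theorem writes_writeUnary {aux : K} (h₁ : src ≠ aux) (h₂ : src ≠ dst) (h₃ : aux ≠ dst) (a d : ℕ)
    {j : ℕ} (hs : s src = List.replicate j true) (ha : s aux = []) :
    Writes (writeUnary src aux dst a d) dst s (encodeUnary (a * j + d))
      (j * (a + 7) + d + 4) := by
  have h := ((writes_copy h₁ h₂ h₃ a hs ha).seq (writes_push dst (List.replicate d true ++ [false])
    s)).mono (t' := j * (a + 7) + d + 4)
    (by simp only [List.length_append, List.length_replicate, List.length_singleton]; omega)
  rwa [← List.append_assoc, List.replicate_append_replicate] at h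

/-- Run `p` with the empty counter `idx` set to `n - 1, …, 0` in turn, where `n` is the value of the
counter `src`, with the help of the empty stack `aux`. -/
def forDown (src aux idx : K) (p : StackProg K) : StackProg K :=
  copy src aux idx 1 ;; loop idx p

theorem writes_forDown {aux idx : K} (h₁ : src ≠ aux) (h₂ : src ≠ idx) (h₃ : aux ≠ idx)
    (h₄ : src ≠ dst) (h₅ : aux ≠ dst) (h₆ : idx ≠ dst) {n : ℕ}
    (hs : s src = List.replicate n true) (ha : s aux = []) (hx : s idx = []) {bits : ℕ → List Bool}
    (h : ∀ i < n, Writes p dst (update s idx (List.replicate i true)) (bits i) t) :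
    Writes (forDown src aux idx p) dst s ((List.range n).reverse.flatMap bits)
      (n * (t + 9) + 3) := by
  intro r
  have set_idx := writes_copy h₁ h₂ h₃ 1 (s := update s dst r) (by simpa [h₄] using hs)
    (by simpa [h₅] using ha) []
  have run_loop := Exec.loop_writes (l := []) h₆ (by simp) (by simpa using h) r
  refine (set_idx.seq (run_loop.congr ?_ rfl le_rfl)).congr ?_ ?_ ?_
  · simp [update_comm h₆]
  · rw [← hx, ← update_of_ne h₆ r s, update_eq_self]
  · rw [List.tail_nil, ← hx, update_eq_self]
  · ring_nf
    omega

theorem Writes.exec_move (h : Writes p k s bs t) (hne : k ≠ dst) (hk : s k = bs'.reverse) :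
    Exec (p ;; move k dst) s (update (update s k []) dst (bs' ++ bs ++ s dst))
      (2 * t + bs'.length + 1) := by
  have length_le := h.length_le
  refine (h.exec.seq (.move hne _)).congr rfl ?_ ?_
  · simp [hk, hne.symm]
  · simp only [update_self, List.length_append, List.length_reverse, hk]
    omega

end Writes

section Transduces

variable {p q : StackProg K} {src dst : K} {s : K → List Bool} {bs bs' cs cs' : List Bool}
  {t t' : ℕ}

/-- Started with the bits of `bs` on top of the stack `src`, and with the stacks `s` otherwise, the
program `p` pops these bits and pushes the bits of `cs` on the stack `dst` from left to right, in
time at most `t`, and leaves the other stacks as they were. -/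
def Transduces (p : StackProg K) (src dst : K) (s : K → List Bool) (bs cs : List Bool) (t : ℕ) :
    Prop :=
  ∀ r r', Exec p (update (update s src (bs ++ r)) dst r')
    (update (update s src r) dst (cs.reverse ++ r')) t

theorem Transduces.seq (hp : Transduces p src dst s bs cs t)
    (hq : Transduces q src dst s bs' cs' t') :
    Transduces (p ;; q) src dst s (bs ++ bs') (cs ++ cs') (t + t') := by
  intro r r'
  simpa using (hp (bs' ++ r) r').seq (hq r _)

end Transduces

end StackProg

namespace JFAWordInstance

/-- The encoding of a rule `p y → q` of an instance. -/
def encodeRule (p : ℕ) (y : Option ℕ) (q : ℕ) : List Bool :=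
  encodeUnary p ++ encodeBlocks encodeUnary y.toList ++ encodeUnary q

-- The coercions of lists of states and of letters in `encode` are elaborated as monadic binds.
theorem encode_eq (I : JFAWordInstance) :
    I.encode = encodeUnary I.numStates ++ encodeUnary I.numLetters ++ encodeUnary I.start ++
      encodeBlocks encodeUnary (I.final.map Fin.val) ++
      encodeBlocks (fun r => encodeRule r.1 (r.2.1.map Fin.val) r.2.2) I.rules ++
      encodeBlocks encodeUnary (I.word.map Fin.val) := by
  have bind_pure_eq_map {n : ℕ} (l : List (Fin n)) : (l >>= fun a => pure (a : ℕ)) =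
      l.map Fin.val :=
    bind_pure_comp _ _
  simp only [encode, encodeRule, bind_pure_eq_map, Option.toList_map]

end JFAWordInstance

namespace ThreeCNF

open Function StackProg
open JFAWordInstance (encodeRule)

/-- The stacks of the program that computes the reduction. The numbers of variables and of clauses
read so far and the index of the current variable are kept in unary in `vars`, `clause` and
`index`. The encoding of the rules is written on `rules` and the other parts of the output on
`scratch`; moving them to `output` puts their first bit on top. -/
inductive Register
  | input
  | vars
  | clause
  | index
  | aux
  | rules
  | scratch
  | output
  deriving DecidableEq

instance : Fintype Register where
  elems := {.input, .vars, .clause, .index, .aux, .rules, .scratch, .output}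
  complete := by rintro ⟨⟩ <;> decide

open Register

/-- The encoding of a clause. -/
def encodeClause {n : ℕ} (c : Clause n) : List Bool :=
  SatLiteral.encode c.1 ++ SatLiteral.encode c.2.1 ++ SatLiteral.encode c.2.2

/-- The blocks of the rules that read the letter `j`, which stands for the clause `c`, in the
encoding of the list of rules. -/
def encodeLoopRules {n : ℕ} (c : Clause n) (j : ℕ) : List Bool :=
  c.literals.flatMap fun l => true :: encodeRule (litState l) (some j) (litState l)

/-- The blocks of all rules that read letters in the encoding of the rules of `φ.toJFA`. -/
def encodeAllLoopRules (φ : ThreeCNF) : List Bool :=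
  φ.clauses.zipIdx.flatMap fun c => encodeLoopRules c.1 c.2

/-- The blocks of the rules that choose the value of `x_i` in the encoding of the list of rules. -/
def encodeChoiceRules (i : ℕ) : List Bool :=
  (true :: encodeRule (3 * i) none (3 * i + 1)) ++ (true :: encodeRule (3 * i + 1) none (3 * i + 3))
    ++ (true :: encodeRule (3 * i) none (3 * i + 2)) ++
    (true :: encodeRule (3 * i + 2) none (3 * i + 3))

/-- Write a rule from the state `3 * i + d` to the state `3 * i + d'`, where `i` is the current
index, given a program that writes the label. -/
def writeRule (d : ℕ) (writeLabel : StackProg Register) (d' : ℕ) : StackProg Register :=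
  push rules [true] ;; writeUnary index aux rules 3 d ;; writeLabel ;;
    writeUnary index aux rules 3 d'

/-- Write a label that consists of the letter of the current clause. -/
def writeLetter : StackProg Register :=
  push rules [true] ;; writeUnary clause aux rules 1 0 ;; push rules [false]

/-- Write the loop that reads the letter of the current clause in the state of a literal of this
clause, which is read from the input. -/
def readLiteral : StackProg Register :=
  addTo input index ;;
    ite input (writeRule 1 writeLetter 1) (writeRule 2 writeLetter 2) ;; clear index

/-- Write the loops that read the letter of the current clause, which is read from the input. -/
def readClause : StackProg Register :=
  readLiteral ;; readLiteral ;; readLiteral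

/-- Read the clauses of the input and write the loops that read their letters. -/
def readClauses : StackProg Register :=
  loop input (readClause ;; push clause [true])

/-- Read a formula and write the loops of the automaton. -/
def readFormula : StackProg Register :=
  addTo input vars ;; readClauses

/-- Write the rules that choose the values of the variables. -/
def writeChoices : StackProg Register :=
  forDown vars aux index
    (writeRule 0 (push rules [false]) 1 ;; writeRule 1 (push rules [false]) 3 ;;
      writeRule 0 (push rules [false]) 2 ;; writeRule 2 (push rules [false]) 3)

/-- Write the list of all letters. -/
def writeWord : StackProg Register :=
  forDown clause aux index (push scratch [true] ;; writeUnary index aux scratch 1 0) ;;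
    push scratch [false]

/-- Write everything that precedes the rules in the encoding of an instance. -/
def writeHeader : StackProg Register :=
  writeUnary vars aux scratch 3 1 ;; writeUnary clause aux scratch 1 0 ;;
    push scratch [false, true] ;; writeUnary vars aux scratch 3 0 ;; push scratch [false]

/-- Complete the rules and write the output, beginning at its end. -/
def writeInstance : StackProg Register :=
  (writeWord ;; move scratch output) ;;
    ((writeChoices ;; push rules [false]) ;; move rules output) ;;
    (writeHeader ;; move scratch output)

/-- The program that computes the encoding of `φ.toJFA` from that of `φ`. -/
def reduction : StackProg Register :=
  readFormula ;; writeInstance ;; clear vars ;; clear clause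

section Programs

variable {s : Register → List Bool} {i j n B t : ℕ} {y : Option ℕ}

theorem writes_writeRule (hi : s index = List.replicate i true) (ha : s aux = []) (d d' : ℕ)
    {writeLabel : StackProg Register}
    (h : Writes writeLabel rules s (encodeBlocks encodeUnary y.toList) t) :
    Writes (writeRule d writeLabel d') rules s (true :: encodeRule (3 * i + d) y (3 * i + d'))
      (20 * i + d + d' + t + 10) := by
  have write_state (d : ℕ) := writes_writeUnary (dst := rules) (by decide) (by decide) (by decide)
    3 d hi ha
  have h := (writes_push rules [true] s).seq ((write_state d).seq (h.seq (write_state d')))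
  rw [← List.append_assoc (encodeUnary _)] at h
  exact h.mono (by rw [List.length_singleton]; omega)

theorem writes_writeLetter (hj : s clause = List.replicate j true) (ha : s aux = []) :
    Writes writeLetter rules s (encodeBlocks encodeUnary (some j).toList) (8 * j + 8) := by
  have h := (writes_push rules [true] s).seq ((writes_writeUnary (dst := rules) (by decide)
    (by decide) (by decide) 1 0 hj ha).seq (writes_push rules [false] s))
  rw [one_mul, add_zero] at h
  have encodeBlocks_eq : encodeBlocks encodeUnary (some j).toList =
      [true] ++ (encodeUnary j ++ [false]) := by
    simp [encodeBlocks]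
  rw [encodeBlocks_eq]
  refine h.mono ?_
  simp only [List.length_singleton]
  omega

theorem transduces_readLiteral (hj : s clause = List.replicate j true) (ha : s aux = [])
    (hx : s index = []) (l : SatLiteral n) (hn : n ≤ B) (hjB : j ≤ B) :
    Transduces readLiteral input rules s l.encode
      (true :: encodeRule (litState l) (some j) (litState l)) (40 * (B + 1)) := by
  intro r r'
  obtain ⟨i, b⟩ := l
  have hi := i.2
  have read_index := exec_addTo (src := input) (dst := index) (by decide) (j := i)
    (s := update (update s input (encodeUnary i ++ (b :: r))) rules r') (l := false :: b :: r)
    (by simp [encodeUnary]) (by simp)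
  have write_rule (d : ℕ) := writes_writeRule
    (s := update (update s input r) index (List.replicate i true)) (i := i) (by simp) (by simp [ha])
    d d (writes_writeLetter (j := j) (by simp [hj]) (by simp [ha])) r'
  have test_sign : Exec (ite input (writeRule 1 writeLetter 1) (writeRule 2 writeLetter 2))
      (update (update (update s input (b :: r)) index (List.replicate i true)) rules r')
      (update (update (update s input r) index (List.replicate i true)) rules
        ((true :: encodeRule (litState (i, b)) (some j) (litState (i, b))).reverse ++ r'))
      (20 * i + 8 * j + 23) := by
    cases b with
    | true =>
      refine (Exec.ite_true (l := r) (by simp)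
        ((write_rule 1).congr ?_ rfl le_rfl)).congr rfl rfl ?_
      · funext k; cases k <;> simp
      · omega
    | false =>
      refine (Exec.ite_false (by simp) ((write_rule 2).congr ?_ rfl le_rfl)).congr rfl rfl ?_
      · funext k; cases k <;> simp
      · omega
  refine (read_index.seq ((test_sign.congr ?_ rfl le_rfl).seq (exec_clear (j := i) ?_))).congr
    ?_ ?_ ?_
  · funext k; cases k <;> simp [hx]
  · simp
  · funext k; cases k <;> simp [SatLiteral.encode]
  · funext k; cases k <;> simp [hx]
  · omega

theorem transduces_readClause (hj : s clause = List.replicate j true) (ha : s aux = [])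
    (hx : s index = []) (c : Clause n) (hn : n ≤ B) (hjB : j ≤ B) :
    Transduces readClause input rules s (encodeClause c) (encodeLoopRules c j) (120 * (B + 1)) := by
  have h (l : SatLiteral n) := transduces_readLiteral hj ha hx l hn hjB
  have h := (h c.1).seq ((h c.2.1).seq (h c.2.2))
  intro r r'
  refine (h r r').congr ?_ ?_ (by omega)
  · simp [encodeClause]
  · simp [encodeLoopRules, Clause.literals]

theorem exec_readClauses (hj : s clause = List.replicate j true) (ha : s aux = [])
    (hx : s index = []) (cs : List (Clause n)) (hs : s input = encodeBlocks encodeClause cs)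
    (hn : n ≤ B) (hjB : j + cs.length ≤ B) :
    Exec readClauses s
      (update (update (update s input []) clause (List.replicate (j + cs.length) true)) rules
        (((cs.zipIdx j).flatMap fun c => encodeLoopRules c.1 c.2).reverse ++ s rules))
      (cs.length * (120 * (B + 1) + 3) + 1) := by
  induction cs generalizing s j with
  | nil =>
    refine (Exec.loop_exit (by simp [hs, encodeBlocks])).congr rfl ?_ (by omega)
    funext k; cases k <;> simp [hs, hj, encodeBlocks]
  | cons c cs ih =>
    rw [List.length_cons] at hjB
    have read_clause := transduces_readClause hj ha hx c hn (by omega)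
      (encodeBlocks encodeClause cs) (s rules)
    refine (Exec.loop_step (l := encodeClause c ++ encodeBlocks encodeClause cs)
      (by simp [hs, encodeBlocks]) ((read_clause.congr ?_ rfl le_rfl).seq (.push clause [true] _))
      (ih (j := j + 1) ?_ ?_ ?_ ?_ (by omega))).congr rfl ?_ ?_
    · funext k; cases k <;> simp
    · simp [hj, List.replicate_succ]
    · simp [ha]
    · simp [hx]
    · simp
    · funext k; cases k <;> simp [List.zipIdx_cons, add_comm, add_left_comm]
    · simp only [List.length_cons, List.length_nil]
      ring_nf
      omega

theorem writes_writeChoices (hv : s vars = List.replicate n true) (ha : s aux = [])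
    (hx : s index = []) :
    Writes writeChoices rules s ((List.range n).reverse.flatMap encodeChoiceRules)
      (n * (80 * n + 69) + 3) := by
  refine writes_forDown (by decide) (by decide) (by decide) (by decide) (by decide) (by decide)
    hv ha hx fun i hi => ?_
  have write_rule (d d' : ℕ) := writes_writeRule (s := update s index (List.replicate i true))
    (i := i) (y := none) (by simp) (by simpa using ha) d d' (writes_push rules [false] _)
  have h := (write_rule 0 1).seq ((write_rule 1 3).seq ((write_rule 0 2).seq (write_rule 2 3)))
  rw [← List.append_assoc, ← List.append_assoc] at h
  refine h.mono ?_
  rw [List.length_singleton]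
  omega

theorem writes_writeWord (hj : s clause = List.replicate j true) (ha : s aux = [])
    (hx : s index = []) :
    Writes writeWord scratch s (encodeBlocks encodeUnary (List.range j).reverse)
      (j * (8 * j + 15) + 5) := by
  refine (writes_forDown (by decide) (by decide) (by decide) (by decide) (by decide) (by decide)
    hj ha hx fun i hi => ?_).seq (writes_push scratch [false] s)
  have h := (writes_push scratch [true] _).seq (writes_writeUnary (src := index)
    (aux := aux) (dst := scratch) (s := update s index (List.replicate i true)) (j := i)
    (by decide) (by decide) (by decide) 1 0 (by simp) (by simpa using ha))
  rw [one_mul, add_zero] at h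
  refine h.mono ?_
  rw [List.length_singleton]
  omega

/-- The part of the encoding of `φ.toJFA` that precedes the rules, for a formula `φ` with `n`
variables and `m` clauses. -/
def encodeHeader (n m : ℕ) : List Bool :=
  encodeUnary (3 * n + 1) ++ encodeUnary m ++ encodeUnary 0 ++ encodeBlocks encodeUnary [3 * n]

theorem writes_writeHeader (hv : s vars = List.replicate n true)
    (hj : s clause = List.replicate j true) (ha : s aux = []) :
    Writes writeHeader scratch s (encodeHeader n j) (20 * n + 8 * j + 18) := by
  have write_vars (d : ℕ) := writes_writeUnary (dst := scratch) (by decide) (by decide) (by decide)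
    3 d hv ha
  have write_clause := writes_writeUnary (dst := scratch) (by decide) (by decide) (by decide)
    1 0 hj ha
  have h := (write_vars 1).seq (write_clause.seq ((writes_push scratch [false, true] s).seq
    ((write_vars 0).seq (writes_push scratch [false] s))))
  intro r
  refine (h r).congr rfl ?_ ?_
  · simp [encodeHeader, encodeBlocks, encodeUnary]
  · simp only [List.length_cons, List.length_nil]
    omega

theorem exec_writeInstance (hv : s vars = List.replicate n true)
    (hj : s clause = List.replicate j true) (ha : s aux = []) (hx : s index = [])
    (hs : s scratch = []) {bs : List Bool} (hr : s rules = bs.reverse) (ho : s output = []) :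
    Exec writeInstance s
      (update (update s rules []) output (encodeHeader n j ++
        (bs ++ (List.range n).reverse.flatMap encodeChoiceRules ++ [false]) ++
        encodeBlocks encodeUnary (List.range j).reverse))
      (160 * n ^ 2 + 178 * n + 16 * j ^ 2 + 46 * j + bs.length + 59) := by
  have write_word :=
    (writes_writeWord hj ha hx).exec_move (dst := output) (bs' := []) (by decide) hs
  have write_rules (w : List Bool) := ((writes_writeChoices (n := n) (s := update s output w)
    (by simpa) (by simpa) (by simpa)).seq (writes_push rules [false] _)).exec_move
    (dst := output) (by decide) (by simpa using hr)
  have write_header (w : List Bool) := (writes_writeHeader (n := n) (j := j)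
    (s := update (update s rules []) output w) (by simpa) (by simpa) (by simpa)).exec_move
    (dst := output) (bs' := []) (by decide) (by simpa)
  let word := encodeBlocks encodeUnary (List.range j).reverse
  let rulesAndWord := bs ++ ((List.range n).reverse.flatMap encodeChoiceRules ++ [false]) ++ word
  refine (write_word.seq (((write_rules word).congr ?_ ?_ le_rfl).seq
    (write_header rulesAndWord))).congr rfl ?_ ?_
  · funext k; cases k <;> simp [hs, ho, word]
  · funext k; cases k <;> simp [rulesAndWord]
  · funext k; cases k <;> simp [hs, rulesAndWord, word]
  · simp only [List.length_singleton, List.length_nil]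
    ring_nf
    omega

end Programs

theorem zipIdx_flatMap_eq {α β : Type} (l : List α) (g : α → ℕ → List β) :
    (l.zipIdx.flatMap fun x => g x.1 x.2) =
      (List.finRange l.length).flatMap fun j => g (l.get j) j := by
  have zipIdx_eq : l.zipIdx = (List.finRange l.length).map fun j => (l.get j, (j : ℕ)) :=
    List.ext_getElem (by simp) (by simp)
  rw [zipIdx_eq, List.flatMap_map]

theorem encode_toJFA (φ : ThreeCNF) :
    φ.toJFA.encode = encodeHeader φ.numVars φ.clauses.length ++
      (φ.encodeAllLoopRules ++
        (List.range φ.numVars).reverse.flatMap encodeChoiceRules ++ [false]) ++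
      encodeBlocks encodeUnary (List.range φ.clauses.length).reverse := by
  have encode_rules : encodeBlocks (fun r => encodeRule r.1 (r.2.1.map Fin.val) r.2.2)
      φ.toJFA.rules = φ.encodeAllLoopRules ++
        (List.range φ.numVars).reverse.flatMap encodeChoiceRules ++ [false] := by
    rw [encodeAllLoopRules, encodeBlocks, toJFA, List.flatMap_append, List.flatMap_assoc,
      List.flatMap_assoc, zipIdx_flatMap_eq, ← List.map_coe_finRange_eq_range,
      ← List.map_reverse, List.flatMap_map]
    refine congrArg (· ++ [false]) (congrArg₂ (· ++ ·) ?_ ?_)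
    · rfl
    · simp [choiceRules, encodeChoiceRules, hub, litState, Nat.mul_succ]
  have encode_word : φ.toJFA.word.map Fin.val = (List.range φ.clauses.length).reverse := by
    rw [← List.map_coe_finRange_eq_range, ← List.map_reverse]
    rfl
  rw [JFAWordInstance.encode_eq, encode_rules, encode_word]
  rfl

theorem encode_eq (φ : ThreeCNF) :
    φ.encode = encodeUnary φ.numVars ++ encodeBlocks encodeClause φ.clauses :=
  rfl

theorem numVars_le_length_encode (φ : ThreeCNF) : φ.numVars ≤ φ.encode.length := by
  simp [encode_eq, encodeUnary]

theorem length_le_length_encodeBlocks {α : Type} (enc : α → List Bool) (l : List α) :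
    l.length ≤ (encodeBlocks enc l).length := by
  induction l with
  | nil => exact Nat.zero_le _
  | cons x l ih =>
    simp only [encodeBlocks, List.flatMap_cons, List.length_append, List.length_cons] at ih ⊢
    omega

theorem length_clauses_le_length_encode (φ : ThreeCNF) :
    φ.clauses.length ≤ φ.encode.length := by
  rw [encode_eq, List.length_append]
  exact le_add_left (length_le_length_encodeBlocks encodeClause φ.clauses)

theorem exec_readFormula (φ : ThreeCNF) :
    Exec readFormula (update (fun _ => []) input φ.encode)
      (update (update (update (fun _ => []) vars (List.replicate φ.numVars true)) clause
        (List.replicate φ.clauses.length true)) rules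
        φ.encodeAllLoopRules.reverse)
      (126 * (φ.encode.length + 1) ^ 2) := by
  have hn := φ.numVars_le_length_encode
  have hm := φ.length_clauses_le_length_encode
  have read_vars := exec_addTo (src := input) (dst := vars) (by decide) (j := φ.numVars)
    (s := update (fun _ => []) input φ.encode)
    (l := false :: encodeBlocks encodeClause φ.clauses) (by simp [encode_eq, encodeUnary]) (by simp)
  have read_clauses := exec_readClauses (j := 0) (B := φ.encode.length)
    (s := update (update (fun _ => []) input (encodeBlocks encodeClause φ.clauses)) vars
      (List.replicate φ.numVars true))
    (by simp) (by simp) (by simp) φ.clauses (by simp) hn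
    (by simpa using hm)
  refine (read_vars.seq (read_clauses.congr (by simp) rfl le_rfl)).congr rfl ?_ ?_
  · funext k; cases k <;> simp [encodeAllLoopRules]
  · nlinarith

theorem exec_reduction (φ : ThreeCNF) :
    Exec reduction (update (fun _ => []) input φ.encode)
      (update (fun _ => []) output φ.toJFA.encode) (1000 * (φ.encode.length + 1) ^ 2) := by
  have hn := φ.numVars_le_length_encode
  have hm := φ.length_clauses_le_length_encode
  have read := φ.exec_readFormula
  have length_rules_le := read.length_le rules
  have write := exec_writeInstance (s := update (update (update (fun _ => []) vars
    (List.replicate φ.numVars true)) clause (List.replicate φ.clauses.length true)) rules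
      φ.encodeAllLoopRules.reverse) (bs := φ.encodeAllLoopRules)
    (n := φ.numVars) (j := φ.clauses.length) (by simp) (by simp) (by simp) (by simp) (by simp)
    (by simp) (by simp)
  rw [← encode_toJFA] at write
  refine (read.seq (write.seq ((exec_clear (j := φ.numVars) (by simp)).seq
    (exec_clear (j := φ.clauses.length) (by simp))))).congr rfl ?_ ?_
  · funext k; cases k <;> simp
  · simp only [update_self, List.length_reverse, ne_eq, reduceCtorEq, not_false_eq_true,
      update_of_ne, List.length_nil, zero_add] at length_rules_le
    nlinarith

/-- The reduction is computable in polynomial time. -/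
noncomputable def toJFAComputableInPolyTime :
    Turing.TM2ComputableInPolyTime encode JFAWordInstance.encode toJFA :=
  computableInPolyTime reduction input output (1000 * (Polynomial.X + 1) ^ 2) fun φ => by
    simpa using φ.exec_reduction

end ThreeCNF

theorem mainTheorem7 (hETH : ExponentialTimeHypothesis) :
    ¬ DecidableInSubexpTime JFAWordInstance.encode JFAWordInstance.numStates
        JFAWordInstance.Accepts :=
  fun h => hETH (h.of_polyTimeReduction ThreeCNF.toJFAComputableInPolyTime (a := 3) (b := 1)
    (fun _ => le_rfl) fun _ => ThreeCNF.accepts_toJFA_iff)
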